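/- Call $f:\{1,2,3,\dots\}\to\mathbb R_{>0}$ a *Floyd function* if $\sum_{n\ge 1} f(n)<\infty$ and there is $\lambda>0$ with $f(n)\ge f(n+1)\ge\lambda f(n)$ for all $n\ge 1$; put $f(0):=f(1)$. Let $G$ be a group with a finite generating set $S$, let $\Gamma_{G,S}$ be its Cayley graph (edges joining $g$ and $gs$, $s\in S$) and $d$ its graph metric. Give an edge joining $g$ and $h$ the length $f(\min\{d(1,g),d(1,h)\})$, and let $d_f(g,h)$ be the infimum of the total lengths of edge paths in $\Gamma_{G,S}$ from $g$ to $h$. The *Floyd boundary* $\partial_f(G,S)$ is the complement of $G$ in the Cauchy completion of $(G,d_f)$, with the subspace topology. Let $A$ be a finitely generated group, $F,F'\le A$ finite subgroups, $\varphi:F\to F'$ an isomorphism, $G=A*_{F\simeq F'}$ the corresponding HNN extension with stable letter $t$, and $f$ a Floyd function. 1. Suppose that $A$ is infinite. (a) If $S_A$ is a finite generating set of $A$ containing $F\setminus\{1\}$ and $F'\setminus\{1\}$, then $\partial_f(G,S_A\cup\{t\})$ is homeomorphic to $\partial_f(A*A,\,S_A\sqcup S_A')$, where $S_A\sqcup S_A'$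 is the union of the copies of $S_A$ in the two free factors. (b) If in addition there is a constant $D$ with $f(n)\le D f(2n)$ for all $n$, then $\partial_f(G,S)$ is homeomorphic to $\partial_f(A*A,S')$ for all finite generating sets $S$ of $G$ and $S'$ of $A*A$. 2. If $A$ is finite and $F\ne A$ or $F'\ne A$, then for every finite generating set $S$ of $G$ the Floyd boundary $\partial_f(G,S)$ is homeomorphic to the Cantor set. -/

import Mathlib

open Topology
open scoped ENNReal

/-- A Floyd function: a positive, summable, non-increasing function on the positive integers which
decays at most geometrically, extended to `0` by `f 0 = f 1`. -/
structure IsFloydFunction (f : ℕ → ℝ) : Prop where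
  zero_eq : f 0 = f 1
  pos : ∀ n, 1 ≤ n → 0 < f n
  summable : Summable f
  antitone : ∀ n, 1 ≤ n → f (n + 1) ≤ f n
  decay : ∃ c : ℝ, 0 < c ∧ ∀ n, 1 ≤ n → c * f n ≤ f (n + 1)

/-- `S` is a finite generating set of the group `G`. -/
def IsFiniteGenSet {G : Type*} [Group G] (S : Set G) : Prop :=
  S.Finite ∧ Subgroup.closure S = ⊤

section Floyd

variable {G : Type*} [Group G]

/-- The rescaled length of an edge `{g, h}` of the Cayley graph of `G` with respect to `S`: the
value of `f` at the (graph) distance from the identity to `{g, h}`. -/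
noncomputable def floydEdgeLength (f : ℕ → ℝ) (S : Set G) (g h : G) : ℝ≥0∞ :=
  ENNReal.ofReal (f (min ((SimpleGraph.mulCayley S).dist 1 g) ((SimpleGraph.mulCayley S).dist 1 h)))

/-- The Floyd length of an edge path in the Cayley graph. -/
noncomputable def floydLength (f : ℕ → ℝ) (S : Set G) {g h : G}
    (p : (SimpleGraph.mulCayley S).Walk g h) : ℝ≥0∞ :=
  (p.darts.map fun d => floydEdgeLength f S d.fst d.snd).sum

/-- The Floyd distance of two vertices of the Cayley graph: the infimum of the Floyd lengths of the
edge paths joining them (finite as soon as `S` generates `G`). -/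
noncomputable def floydEDist (f : ℕ → ℝ) (S : Set G) (g h : G) : ℝ≥0∞ :=
  ⨅ p : (SimpleGraph.mulCayley S).Walk g h, floydLength f S p

theorem floydEdgeLength_comm (f : ℕ → ℝ) (S : Set G) (g h : G) :
    floydEdgeLength f S g h = floydEdgeLength f S h g := by
  simp only [floydEdgeLength, min_comm]

theorem floydLength_append (f : ℕ → ℝ) (S : Set G) {g h k : G}
    (p : (SimpleGraph.mulCayley S).Walk g h) (q : (SimpleGraph.mulCayley S).Walk h k) :
    floydLength f S (p.append q) = floydLength f S p + floydLength f S q := by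
  simp [floydLength, SimpleGraph.Walk.darts_append]

theorem floydLength_reverse (f : ℕ → ℝ) (S : Set G) {g h : G}
    (p : (SimpleGraph.mulCayley S).Walk g h) :
    floydLength f S p.reverse = floydLength f S p := by
  simp only [floydLength, SimpleGraph.Walk.darts_reverse, List.map_reverse, List.sum_reverse,
    List.map_map]
  congr 1
  refine List.map_congr_left fun d _ => ?_
  exact floydEdgeLength_comm f S _ _

theorem floydEDist_self (f : ℕ → ℝ) (S : Set G) (g : G) : floydEDist f S g g = 0 :=
  le_antisymm ((iInf_le _ SimpleGraph.Walk.nil).trans (by simp [floydLength])) bot_le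

theorem floydEDist_comm (f : ℕ → ℝ) (S : Set G) (g h : G) :
    floydEDist f S g h = floydEDist f S h g := by
  have key : ∀ a b : G, floydEDist f S a b ≤ floydEDist f S b a := fun a b =>
    le_iInf fun p => (iInf_le _ p.reverse).trans (floydLength_reverse f S p).le
  exact le_antisymm (key g h) (key h g)

theorem floydEDist_triangle (f : ℕ → ℝ) (S : Set G) (g h k : G) :
    floydEDist f S g k ≤ floydEDist f S g h + floydEDist f S h k := by
  unfold floydEDist
  exact ENNReal.le_iInf_add_iInf fun p q =>
    (iInf_le _ (p.append q)).trans (floydLength_append f S p q).le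

/-- The vertex set of the Cayley graph of `G` with respect to `S`, to be equipped with the Floyd
metric. -/
def FloydSpace (_f : ℕ → ℝ) (_S : Set G) : Type _ := G

noncomputable instance (f : ℕ → ℝ) (S : Set G) : PseudoEMetricSpace (FloydSpace f S) where
  edist := floydEDist (G := G) f S
  edist_self := floydEDist_self (G := G) f S
  edist_comm := floydEDist_comm (G := G) f S
  edist_triangle := floydEDist_triangle (G := G) f S

/-- The Floyd boundary of `G` with respect to `f` and the generating set `S`: the points of the
Cauchy completion (with respect to the Floyd metric) that do not lie in the space itself. -/
def floydBoundary (f : ℕ → ℝ) (S : Set G) : Set (UniformSpace.Completion (FloydSpace f S)) :=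
  (Set.range ((↑) : FloydSpace f S → UniformSpace.Completion (FloydSpace f S)))ᶜ

end Floyd

/-- The generating set `S ∪ {t}` of the HNN extension. -/
def hnnGenSet {A : Type*} [Group A] {F F' : Subgroup A} (φ : F ≃* F') (S : Set A) :
    Set (HNNExtension A F F' φ) :=
  (HNNExtension.of '' S) ∪ {HNNExtension.t}

/-- The generating set of `A * A` given by the two copies of `S`. -/
def doubleGenSet {A : Type*} [Group A] (S : Set A) : Set (Monoid.Coprod A A) :=
  (Monoid.Coprod.inl '' S) ∪ (Monoid.Coprod.inr '' S)

/-! The boundary is determined up to homeomorphism by a tree of clopen sets read off the Bass–Serre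
tree. The elements of the HNN extension whose normal form begins in a given way form a halfspace.
Since `F` and `F'` are finite, only finitely many edges of the Cayley graph leave a halfspace. Hence
its limit set in the Floyd boundary is clopen. A geodesic towards the identity must leave a
translated halfspace near its root unless the identity lies inside, so summability of `f` makes all
but finitely many translates missing the identity as small as desired. The limit set of a halfspace
is therefore the limit set of a coset of `A` together with the limit sets of the halfspaces
branching off that coset, and the latter form a null family accumulating at every point of the
former. The same holds for `A * A`, with trivial edge groups. This is axiomatized by
`HalfspaceSystem`, and `HalfspaceSystem.isPieceTree` passes from the group to its boundary.

If `A` is infinite, the limit set of each coset is a copy of the Floyd boundary of `A`: the Cayley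
graph retracts onto that of `A`, and off `A` the retraction is constant along edges
(`isUniformInducing_mul_of_retraction`). For the HNN extension this is where the nontrivial elements
of `F` and `F'` have to be generators. A compact metric space with such a tree of pieces is unique
up to homeomorphism (`IsPieceTree.nonempty_homeomorph`): the subpieces at a node can be enumerated
so as to shadow one fixed sequence clustering at every point of the piece, which identifies the
space with the standard `treeModel`. The boundaries of the HNN extension and of `A * A` both have
this form, with the same pieces. Under the doubling condition, changing generators is bi-Lipschitz
for the Floyd metrics, so (b) follows from (a).

If `A` is finite, cosets have empty limit sets. Branching then makes the boundary a nonempty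
perfect, totally disconnected compact metric space, and Brouwer's theorem applies. -/

open Set Filter

/-! ### Brouwer's characterization of the Cantor set. -/

section CantorSpace

variable {Y : Type*} [TopologicalSpace Y]

/-- If `B` does not cut `U`, perfectness provides two points of `U` and any clopen set separating
them will do. Insisting on `B` whenever it does cut `U` ensures that, along an enumeration of all
clopen sets, no pair of points stays together forever. -/
theorem exists_isClopen_split [TotallySeparatedSpace Y] [PerfectSpace Y]
    {U : Set Y} (hU : IsClopen U) (hne : U.Nonempty) (B : Set Y) (hB : IsClopen B) :
    ∃ V, IsClopen V ∧ (U ∩ V).Nonempty ∧ (U \ V).Nonempty ∧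
      ((U ∩ B).Nonempty → (U \ B).Nonempty → V = B) := by
  by_cases h : (U ∩ B).Nonempty ∧ (U \ B).Nonempty
  · exact ⟨B, hB, h.1, h.2, fun _ _ => rfl⟩
  · obtain ⟨x, hx⟩ := hne
    have hacc : AccPt x (𝓟 univ) := PerfectSpace.univ_preperfect x (mem_univ x)
    rw [accPt_iff_nhds] at hacc
    obtain ⟨y, ⟨hyU, -⟩, hxy⟩ := hacc U (hU.isOpen.mem_nhds hx)
    obtain ⟨V, hV, hyV, hxV⟩ := exists_isClopen_of_totally_separated hxy
    exact ⟨V, hV, ⟨y, hyU, hyV⟩, ⟨x, hx, hxV⟩, fun h1 h2 => absurd ⟨h1, h2⟩ h⟩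

/-- The first `n` values of a sequence, in reverse order. -/
def revPrefix {α : Type*} (x : ℕ → α) : ℕ → List α
  | 0 => []
  | n + 1 => x n :: revPrefix x n

theorem length_revPrefix {α : Type*} (x : ℕ → α) (n : ℕ) : (revPrefix x n).length = n := by
  induction n with
  | zero => rfl
  | succ n ih => simp [revPrefix, ih]

theorem revPrefix_congr {α : Type*} {x y : ℕ → α} {n : ℕ} (h : ∀ i < n, x i = y i) :
    revPrefix x n = revPrefix y n := by
  induction n with
  | zero => rfl
  | succ n ih =>
    rw [revPrefix, revPrefix, h n (Nat.lt_succ_self n), ih fun i hi => h i (hi.trans n.lt_succ_self)]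

/-- **Brouwer's characterization of the Cantor space.** -/
theorem nonempty_homeomorph_cantorSpace [CompactSpace Y] [T2Space Y] [TotallyDisconnectedSpace Y]
    [SecondCountableTopology Y] [PerfectSpace Y] [Nonempty Y] : Nonempty (Y ≃ₜ (ℕ → Bool)) := by
  classical
  have : TotallySeparatedSpace Y := inferInstance
  have : Countable (TopologicalSpace.Clopens Y) :=
    TopologicalSpace.Clopens.countable_iff_secondCountable.2 inferInstance
  obtain ⟨B, hB⟩ := exists_surjective_nat (TopologicalSpace.Clopens Y)
  -- The hypotheses on `U` come after the existential so that `V` can be chosen for all sets before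
  -- the nodes are known to be clopen and nonempty.
  have hsplit : ∀ (U : Set Y) (n : ℕ), ∃ V, IsClopen U → U.Nonempty → IsClopen V ∧
      (U ∩ V).Nonempty ∧ (U \ V).Nonempty ∧
      ((U ∩ B n).Nonempty → (U \ B n).Nonempty → V = B n) := by
    intro U n
    by_cases h : IsClopen U ∧ U.Nonempty
    · obtain ⟨V, hV⟩ := exists_isClopen_split h.1 h.2 (B n) (B n).isClopen
      exact ⟨V, fun _ _ => hV⟩
    · exact ⟨∅, fun h1 h2 => absurd ⟨h1, h2⟩ h⟩
  choose V hV using hsplit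
  let node : List Bool → Set Y := fun s => List.rec univ
    (fun b s U => if b then U ∩ V U s.length else U \ V U s.length) s
  have node_cons : ∀ b s, node (b :: s) =
      if b then node s ∩ V (node s) s.length else node s \ V (node s) s.length := fun _ _ => rfl
  have hnode : ∀ s, IsClopen (node s) ∧ (node s).Nonempty := by
    intro s
    induction s with
    | nil => exact ⟨isClopen_univ, univ_nonempty⟩
    | cons b s ih =>
      obtain ⟨h1, h2, h3, -⟩ := hV (node s) s.length ih.1 ih.2
      rw [node_cons]
      cases b
      · exact ⟨ih.1.diff h1, h3⟩
      · exact ⟨ih.1.inter h1, h2⟩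
  have hsub : ∀ b s, node (b :: s) ⊆ node s := by
    intro b s
    rw [node_cons]
    split_ifs
    · exact inter_subset_left
    · exact sdiff_subset
  have hne : ∀ x : ℕ → Bool, (⋂ n, node (revPrefix x n)).Nonempty := fun x =>
    IsCompact.nonempty_iInter_of_sequence_nonempty_isCompact_isClosed _ (fun n => hsub _ _)
      (fun n => (hnode _).2) (hnode (revPrefix x 0)).1.isClosed.isCompact fun n => (hnode (revPrefix x n)).1.isClosed
  choose F hF using hne
  -- A clopen set separating `y` from `z` is some `B n`; it cuts the node at depth `n`, so it was
  -- the set used there and the branch cannot keep both points.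
  have huniq : ∀ (x : ℕ → Bool) (y z : Y), (∀ n, y ∈ node (revPrefix x n)) →
      (∀ n, z ∈ node (revPrefix x n)) → y = z := by
    intro x y z hy hz
    by_contra hyz
    obtain ⟨C, hC, hyC, hzC⟩ := exists_isClopen_of_totally_separated hyz
    obtain ⟨n, hn⟩ := hB ⟨C, hC⟩
    have hnC : (B n : Set Y) = C := by rw [hn]; rfl
    obtain ⟨h1, h2, h3, h4⟩ := hV (node (revPrefix x n)) n (hnode _).1 (hnode _).2
    have hVB := h4 ⟨y, hy n, hnC ▸ hyC⟩ ⟨z, hz n, hnC ▸ hzC⟩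
    have hy' := hy (n + 1)
    have hz' := hz (n + 1)
    rw [revPrefix, node_cons, length_revPrefix, hVB, hnC] at hy' hz'
    cases hx : x n <;> simp only [hx, if_true, if_false, Bool.false_eq_true] at hy' hz'
    · exact hy'.2 hyC
    · exact hzC hz'.2
  have hFmem : ∀ x n, F x ∈ node (revPrefix x n) := fun x n => mem_iInter.1 (hF x) n
  have hcont : Continuous F := by
    refine continuous_iff_continuousAt.2 fun x => ?_
    intro W hW
    obtain ⟨W', hW'W, hW'o, hxW'⟩ := mem_nhds_iff.1 hW
    have hanti : Antitone fun n => node (revPrefix x n) := antitone_nat_of_succ_le fun n => hsub _ _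
    obtain ⟨n, hn⟩ := exists_subset_nhds_of_isCompact' (U := W')
      (V := fun n => node (revPrefix x n)) (directed_of_isDirected_le hanti)
      (fun n => (hnode _).1.isClosed.isCompact) (fun n => (hnode _).1.isClosed)
      (fun y hy => by
        rw [huniq x y (F x) (fun n => mem_iInter.1 hy n) (hFmem x)]
        exact hW'o.mem_nhds hxW')
    rw [Filter.mem_map]
    refine Filter.mem_of_superset
      ((PiNat.isOpen_cylinder (fun _ => Bool) x n).mem_nhds (PiNat.self_mem_cylinder x n)) ?_
    intro z hz
    refine hW'W (hn ?_)
    have : revPrefix x n = revPrefix z n :=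
      revPrefix_congr fun i hi => ((PiNat.mem_cylinder_iff.1 hz) i hi).symm
    simp only [this]
    exact hFmem z n
  have hinj : Function.Injective F := by
    intro x z hxz
    funext n
    induction n using Nat.strong_induction_on with
    | _ n ih =>
      have h1 := hFmem x (n + 1)
      have h2 := hFmem z (n + 1)
      rw [revPrefix, node_cons] at h1 h2
      rw [← hxz, ← revPrefix_congr ih] at h2
      cases hx : x n <;> cases hz : z n <;> simp_all
  have hsurj : Function.Surjective F := by
    intro y
    let pre : ℕ → List Bool := fun n => Nat.rec []
      (fun _ s => decide (y ∈ V (node s) s.length) :: s) n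
    have hpre : ∀ n, y ∈ node (pre n) := by
      intro n
      induction n with
      | zero => exact mem_univ y
      | succ n ih =>
        change y ∈ node (decide (y ∈ V (node (pre n)) (pre n).length) :: pre n)
        rw [node_cons]
        by_cases h : y ∈ V (node (pre n)) (pre n).length
        · simpa [h] using ih
        · simpa [h] using ih
    let x : ℕ → Bool := fun n => decide (y ∈ V (node (pre n)) (pre n).length)
    have hx : ∀ n, revPrefix x n = pre n := by
      intro n
      induction n with
      | zero => rfl
      | succ n ih => rw [revPrefix, ih]
    exact ⟨x, huniq x _ _ (hFmem x) fun n => (hx n) ▸ hpre n⟩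
  exact ⟨(Continuous.homeoOfEquivCompactToT2 (f := Equiv.ofBijective F ⟨hinj, hsurj⟩) hcont).symm⟩

end CantorSpace

/-! ### Matching two sequences that cluster everywhere. -/

section Matching

/-- Each sequence injects into the other with error at most `1 / (n + 1)`. The Schröder–Bernstein
bijection uses one of the two injections at each index, so its error is below `1 / (n + 1) + 1 / (σ
n + 1)`, and `σ n` tends to infinity by injectivity. -/
theorem exists_perm_tendsto_dist {K : Type*} [PseudoMetricSpace K] {p q : ℕ → K}
    (hp : ∀ k, MapClusterPt k atTop p) (hq : ∀ k, MapClusterPt k atTop q) :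
    ∃ σ : ℕ ≃ ℕ, Tendsto (fun n => dist (p n) (q (σ n))) atTop (𝓝 0) := by
  have aux : ∀ {p q : ℕ → K}, (∀ k, MapClusterPt k atTop q) →
      ∃ a : ℕ → ℕ, StrictMono a ∧ ∀ n, dist (p n) (q (a n)) < 1 / ((n : ℝ) + 1) := by
    intro p q hq
    refine extraction_forall_of_frequently (P := fun n m => dist (p n) (q m) < 1 / ((n : ℝ) + 1)) fun n => ?_
    have := (hq (p n)).frequently (Metric.ball_mem_nhds (p n) (Nat.one_div_pos_of_nat (n := n)))
    refine this.mono fun m hm => ?_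
    rw [dist_comm]; exact hm
  obtain ⟨a, ha, ha'⟩ := aux (p := p) hq
  obtain ⟨b, hb, hb'⟩ := aux (p := q) hp
  obtain ⟨σ, hσ, hσ'⟩ := Function.Embedding.schroeder_bernstein_of_rel ha.injective hb.injective
    (fun n m => dist (p n) (q m) < 1 / ((n : ℝ) + 1) + 1 / ((m : ℝ) + 1))
    (fun n => (ha' n).trans (lt_add_of_pos_right _ Nat.one_div_pos_of_nat))
    (fun m => by
      rw [dist_comm]
      exact (hb' m).trans (lt_add_of_pos_left _ Nat.one_div_pos_of_nat))
  refine ⟨Equiv.ofBijective σ hσ, squeeze_zero (fun _ => dist_nonneg) (fun n => (hσ' n).le) ?_⟩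
  have h1 := tendsto_one_div_add_atTop_nhds_zero_nat (𝕜 := ℝ)
  have h2 : Tendsto σ atTop atTop := by
    rw [← Nat.cofinite_eq_atTop]; exact hσ.injective.tendsto_cofinite
  simpa using h1.add (h1.comp h2)

end Matching

/-! ### Trees of pieces and shadowing enumerations. -/

section PieceTree

/-- A null family `𝒰` of clopen subsets of `Y`, each of which is the disjoint union of a copy of `K`
and of members of `𝒰` accumulating at every point of this copy. -/
structure IsPieceTree (K : Type*) [TopologicalSpace K] {Y : Type*} [PseudoMetricSpace Y]
    (𝒰 : Set (Set Y)) : Prop where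
  univ_mem : univ ∈ 𝒰
  isClopen : ∀ U ∈ 𝒰, IsClopen U
  finite_diam : ∀ ε > 0, {U ∈ 𝒰 | ε ≤ Metric.diam U}.Finite
  decomp : ∀ U ∈ 𝒰, ∃ (h : K → Y) (𝒱 : Set (Set Y)), Continuous h ∧ Function.Injective h ∧ 𝒱 ⊆ 𝒰 ∧
    𝒱.PairwiseDisjoint id ∧ (∀ V ∈ 𝒱, Disjoint (range h) V) ∧ U = range h ∪ ⋃₀ 𝒱 ∧
    range h ⊆ closure (⋃₀ 𝒱)

/-- `h` embeds `K` in `U`, and the sets `V n` partition the complement of its image in `U` and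
shadow the sequence `p` in `K`. -/
structure IsShadowedBy {K Y : Type*} [TopologicalSpace K] [PseudoMetricSpace Y] (p : ℕ → K)
    (U : Set Y) (h : K → Y) (V : ℕ → Set Y) : Prop where
  continuous : Continuous h
  injective : Function.Injective h
  pairwise : Pairwise fun m n => Disjoint (V m) (V n)
  disjoint : ∀ n, Disjoint (range h) (V n)
  eq_union : U = range h ∪ ⋃ n, V n
  shadow : ∀ ε > 0, ∀ᶠ n in atTop, ∀ y ∈ V n, dist y (h (p n)) < ε

variable {K : Type*} [MetricSpace K] [CompactSpace K] {Y : Type*} [MetricSpace Y] [CompactSpace Y]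

/-- Uniform continuity of the inverse on the image: on the compact set of pairs at distance at least
`ε`, the distance of the images attains a positive minimum. -/
theorem exists_dist_lt_of_injective {K Y : Type*} [PseudoMetricSpace K] [CompactSpace K]
    [MetricSpace Y] {h : K → Y} (hc : Continuous h) (hi : Function.Injective h)
    {ε : ℝ} (hε : 0 < ε) : ∃ δ > 0, ∀ k k', dist (h k) (h k') < δ → dist k k' < ε := by
  let C : Set (K × K) := {z | ε ≤ dist z.1 z.2}
  have hC : IsCompact C := (isClosed_le continuous_const continuous_dist).isCompact
  rcases C.eq_empty_or_nonempty with h0 | h0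
  · exact ⟨1, one_pos, fun k k' _ => not_le.1 fun hk => (h0 ▸ (show (k, k') ∈ C from hk) :)⟩
  · obtain ⟨z, hz, hmin⟩ := hC.exists_isMinOn h0 (f := fun z : K × K => dist (h z.1) (h z.2))
      (by fun_prop)
    refine ⟨dist (h z.1) (h z.2), dist_pos.2 fun hzz => ?_, fun k k' hk => ?_⟩
    · have hz' : ε ≤ dist z.1 z.2 := hz
      rw [hi hzz, dist_self] at hz'
      exact hz'.not_gt hε
    · by_contra hk'
      exact (hmin (show (k, k') ∈ C from not_lt.1 hk')).not_gt hk

variable {𝒰 : Set (Set Y)}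

/-- Enumerate the subpieces arbitrarily and let `q n` be a point of `K` whose image is nearest to a
point of the `n`-th one. Nullity makes the subpieces shadow `q`, accumulation makes `q` cluster
everywhere, and permuting the enumeration replaces `q` by the prescribed `p`. -/
theorem IsPieceTree.exists_isShadowedBy [Nonempty K] (h𝒰 : IsPieceTree K 𝒰) {p : ℕ → K}
    (hp : ∀ k, MapClusterPt k atTop p) {U : Set Y} (hU : U ∈ 𝒰) :
    ∃ (h : K → Y) (V : ℕ → Set Y), IsShadowedBy p U h V ∧ ∀ n, V n ∈ 𝒰 := by
  obtain ⟨h, 𝒱, hc, hi, h𝒱, hpair, hdisj, hUeq, hclos⟩ := h𝒰.decomp U hU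
  have hne : ∀ V ∈ 𝒰, V.Nonempty := by
    intro V hV
    obtain ⟨h', _, _, _, _, _, _, hV', _⟩ := h𝒰.decomp V hV
    exact ⟨h' (Classical.arbitrary K), hV' ▸ Or.inl (mem_range_self _)⟩
  have hclopen : ∀ V ∈ 𝒱, IsClopen V := fun V hV => h𝒰.isClopen V (h𝒱 hV)
  -- removing finitely many of the pieces does not affect the closure
  have hrem : ∀ 𝒲 : Set (Set Y), 𝒲.Finite → 𝒲 ⊆ 𝒱 → range h ⊆ closure (⋃₀ (𝒱 \ 𝒲)) := by
    rintro 𝒲 h𝒲 hsub _ ⟨k, rfl⟩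
    have h1 : h k ∈ closure (⋃₀ 𝒲 ∪ ⋃₀ (𝒱 \ 𝒲)) := by
      rw [← sUnion_union, union_sdiff_cancel hsub]; exact hclos (mem_range_self k)
    rw [closure_union] at h1
    refine h1.resolve_left fun h2 => ?_
    have h3 : IsClosed (⋃₀ 𝒲) := by
      rw [sUnion_eq_biUnion]
      exact h𝒲.isClosed_biUnion fun V hV => (hclopen V (hsub hV)).isClosed
    rw [h3.closure_eq] at h2
    obtain ⟨V, hV, hkV⟩ := h2
    exact disjoint_left.1 (hdisj V (hsub hV)) (mem_range_self k) hkV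
  have hinf : 𝒱.Infinite := by
    intro hfin
    have := hrem 𝒱 hfin Subset.rfl (mem_range_self (Classical.arbitrary K))
    simp at this
  have hcount : 𝒱.Countable := hpair.countable_of_isOpen (fun V hV => (hclopen V hV).isOpen)
    fun V hV => hne V (h𝒱 hV)
  have := hcount.to_subtype
  have := hinf.to_subtype
  obtain ⟨hden⟩ := nonempty_denumerable 𝒱
  let e : ℕ ≃ 𝒱 := (Denumerable.eqv 𝒱).symm
  have hW : ∀ n, ∃ y, y ∈ (e n : Set Y) := fun n => hne _ (h𝒱 (e n).2)
  choose w hw using hW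
  have hq : ∀ n, ∃ k, Metric.infDist (w n) (range h) = dist (w n) (h k) := by
    intro n
    obtain ⟨_, ⟨k, rfl⟩, hk⟩ := (isCompact_range hc).exists_infDist_eq_dist (range_nonempty h) (w n)
    exact ⟨k, hk⟩
  choose q hq using hq
  have hfin : ∀ P : Set Y → Prop, {V ∈ 𝒱 | ¬ P V}.Finite → ∀ᶠ n in atTop, P (e n) := by
    intro P hP
    rw [← Nat.cofinite_eq_atTop]
    refine (hP.preimage ((Subtype.val_injective.comp e.injective).injOn)).subset fun n hn => ?_
    exact ⟨(e n).2, hn⟩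
  have hUcl : IsClosed U := (h𝒰.isClopen U hU).isClosed
  have hshadow : ∀ ε > 0, ∀ᶠ n in atTop, ∀ y ∈ (e n : Set Y), dist y (h (q n)) < ε := by
    intro ε hε
    -- The part of `U` away from the copy of `K` is compact and covered by disjoint open subpieces,
    -- so only finitely many of them reach it.
    have h1 : ∀ᶠ n in atTop, (e n : Set Y) ⊆ Metric.thickening (ε / 2) (range h) := by
      refine hfin (fun V => V ⊆ Metric.thickening (ε / 2) (range h)) ?_
      have hcomp : IsCompact (U \ Metric.thickening (ε / 2) (range h)) :=
        (hUcl.sdiff Metric.isOpen_thickening).isCompact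
      obtain ⟨t, ht𝒱, htfin, ht⟩ := hcomp.elim_finite_subcover_image (b := 𝒱) (c := id)
        (fun V hV => (hclopen V hV).isOpen) (by
          rintro y ⟨hyU, hy⟩
          rw [hUeq] at hyU
          rcases hyU with hyU | ⟨V, hV, hyV⟩
          · exact absurd (Metric.self_subset_thickening (half_pos hε) _ hyU) hy
          · exact mem_biUnion hV hyV)
      refine htfin.subset ?_
      rintro V ⟨hV, hVn⟩
      obtain ⟨y, hyV, hy⟩ := not_subset.1 hVn
      obtain ⟨V', hV', hyV'⟩ := mem_iUnion₂.1 (ht ⟨hUeq ▸ Or.inr ⟨V, hV, hyV⟩, hy⟩)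
      rwa [hpair.elim_set hV (ht𝒱 hV') y hyV hyV']
    have h2 : ∀ᶠ n in atTop, Metric.diam (e n : Set Y) < ε / 2 := by
      refine hfin (fun V => Metric.diam V < ε / 2) ((h𝒰.finite_diam _ (half_pos hε)).subset ?_)
      rintro V ⟨hV, hVn⟩
      exact ⟨h𝒱 hV, not_lt.1 hVn⟩
    filter_upwards [h1, h2] with n hn1 hn2 y hy
    have h3 : dist (w n) (h (q n)) < ε / 2 := by
      rw [← hq]
      obtain ⟨z, hz, hwz⟩ := Metric.mem_thickening_iff.1 (hn1 (hw n))
      exact (Metric.infDist_le_dist_of_mem hz).trans_lt hwz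
    have h4 : dist y (w n) < ε / 2 := (Metric.dist_le_diam_of_mem
      (Bornology.IsBounded.all _) hy (hw n)).trans_lt hn2
    linarith [dist_triangle y (w n) (h (q n))]
  have hqclus : ∀ k, MapClusterPt k atTop q := by
    intro k
    rw [mapClusterPt_iff_frequently]
    intro s hs
    obtain ⟨ε, hε, hεs⟩ := Metric.mem_nhds_iff.1 hs
    obtain ⟨δ, hδ, hδε⟩ := exists_dist_lt_of_injective hc hi hε
    obtain ⟨N, hN⟩ := eventually_atTop.1 (hshadow (δ / 2) (half_pos hδ))
    rw [frequently_atTop]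
    intro M
    -- Discarding the first `max M N` subpieces forces a late index while keeping `h k` in the
    -- closure of the rest.
    have hfinW : ((fun n => (e n : Set Y)) '' Iio (max M N)).Finite := (finite_Iio _).image _
    have hk := hrem _ hfinW (by rintro _ ⟨n, -, rfl⟩; exact (e n).2) (mem_range_self k)
    obtain ⟨y, ⟨V, ⟨hV, hVn⟩, hyV⟩, hyk⟩ := Metric.mem_closure_iff.1 hk (δ / 2) (half_pos hδ)
    obtain ⟨n, hn⟩ := e.surjective ⟨V, hV⟩
    have hen : (e n : Set Y) = V := by rw [hn]
    have hnMN : max M N ≤ n := not_lt.1 fun hlt => hVn ⟨n, hlt, hen⟩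
    refine ⟨n, (le_max_left _ _).trans hnMN, hεs (hδε _ _ ?_)⟩
    have := hN n ((le_max_right _ _).trans hnMN) y (hen ▸ hyV)
    rw [dist_comm] at this hyk
    linarith [dist_triangle (h (q n)) y (h k)]
  obtain ⟨σ, hσ⟩ := exists_perm_tendsto_dist hp hqclus
  refine ⟨h, fun n => e (σ n), ⟨hc, hi, ?_, fun n => hdisj _ (e _).2, ?_, ?_⟩,
    fun n => h𝒱 (e _).2⟩
  · intro m n hmn
    refine hpair (e _).2 (e _).2 fun heq => hmn ?_
    exact σ.injective (e.injective (Subtype.ext heq))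
  · rw [hUeq, sUnion_eq_iUnion, ← (σ.trans e).surjective.iUnion_comp]
    rfl
  · intro ε hε
    have hu := CompactSpace.uniformContinuous_of_continuous hc
    obtain ⟨δ, hδ, hδε⟩ := Metric.uniformContinuous_iff.1 hu (ε / 2) (half_pos hε)
    have h1 := σ.injective.nat_tendsto_atTop.eventually (hshadow (ε / 2) (half_pos hε))
    have h2 := (tendsto_order.1 hσ).2 δ hδ
    filter_upwards [h1, h2] with n hn1 hn2 y hy
    have h3 := hn1 y hy
    rw [dist_comm] at hn2
    linarith [hδε hn2, dist_triangle y (h (q (σ n))) (h (p n))]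

end PieceTree

/-! ### Uniqueness of a space with a tree of pieces. -/

section TreeModel

/-- The standard model of a compact space with a tree of pieces homeomorphic to `K`, where `p` is a
sequence in `K`, each point of which is a cluster point: at the node `s` of the tree of finite
sequences of natural numbers, a point either lies on the copy of `K` (at height `0`), or in the
`n`-th piece below `s` (at height `1 / (n + 1)` over `p n`), or not below `s` (at height `-1`). -/
def treeModel {K : Type*} (p : ℕ → K) : Set (List ℕ → K × ℝ) :=
  {x | 0 ≤ (x []).2 ∧ ∀ s,
    (0 ≤ (x s).2 → (x s).2 = 0 ∨ ∃ n : ℕ, x s = (p n, 1 / ((n : ℝ) + 1))) ∧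
    (¬ 0 ≤ (x s).2 → x s = (p 0, -1)) ∧
    ∀ n : ℕ, 0 ≤ (x (n :: s)).2 ↔ x s = (p n, 1 / ((n : ℝ) + 1))}

theorem one_div_nat_add_one_inj {m n : ℕ} (h : 1 / ((m : ℝ) + 1) = 1 / ((n : ℝ) + 1)) : m = n := by
  rw [one_div, one_div, inv_inj, add_left_inj, Nat.cast_inj] at h
  exact h

variable {K : Type*} [MetricSpace K] [CompactSpace K] {Y : Type*} [MetricSpace Y] [CompactSpace Y]
  {𝒰 : Set (Set Y)}

/-- A point is sent to the family of its positions at all nodes. Shadowing gives continuity, nullity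
gives injectivity and compactness gives surjectivity; a continuous bijection from a compact space to
a Hausdorff one is a homeomorphism. -/
theorem IsPieceTree.nonempty_homeomorph_treeModel [Nonempty K] (h𝒰 : IsPieceTree K 𝒰) {p : ℕ → K}
    (hp : ∀ k, MapClusterPt k atTop p) : Nonempty (Y ≃ₜ treeModel p) := by
  classical
  have hex : ∀ U : Set Y, ∃ (h : K → Y) (V : ℕ → Set Y), U ∈ 𝒰 →
      IsShadowedBy p U h V ∧ ∀ n, V n ∈ 𝒰 := by
    intro U
    by_cases hU : U ∈ 𝒰
    · obtain ⟨h, V, hV⟩ := h𝒰.exists_isShadowedBy hp hU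
      exact ⟨h, V, fun _ => hV⟩
    · obtain ⟨h, -⟩ := h𝒰.decomp _ h𝒰.univ_mem
      exact ⟨h, fun _ => ∅, fun h => absurd h hU⟩
  choose h V hhV using hex
  let node : List ℕ → Set Y := fun s => List.rec univ (fun n _ U => V U n) s
  have node_cons : ∀ n s, node (n :: s) = V (node s) n := fun _ _ => rfl
  have node_nil : ∀ y, y ∈ node [] := mem_univ
  have node_nil_mem : node [] ∈ 𝒰 := h𝒰.univ_mem
  clear_value node
  have hnode : ∀ s, node s ∈ 𝒰 := by
    intro s
    induction s with
    | nil => exact node_nil_mem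
    | cons n s ih => exact node_cons n s ▸ (hhV _ ih).2 n
  have hsh : ∀ s, IsShadowedBy p (node s) (h (node s)) (V (node s)) := fun s => (hhV _ (hnode s)).1
  have hcl : ∀ s, IsClopen (node s) := fun s => h𝒰.isClopen _ (hnode s)
  have hVsub : ∀ s n, node (n :: s) ⊆ node s := by
    intro s n y hy
    rw [(hsh s).eq_union]
    exact Or.inr (mem_iUnion.2 ⟨n, node_cons n s ▸ hy⟩)
  have hhsub : ∀ s k, h (node s) k ∈ node s := by
    intro s k
    have := (hsh s).eq_union
    rw [this]
    exact Or.inl ⟨k, this ▸ rfl⟩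
  have hcases : ∀ s y, y ∈ node s → (∃ k, h (node s) k = y) ∨ ∃ n, y ∈ node (n :: s) := by
    intro s y hy
    rw [(hsh s).eq_union] at hy
    simpa [node_cons] using hy
  have hhV_disj : ∀ s k n, h (node s) k ∉ node (n :: s) := fun s k n hk =>
    disjoint_left.1 ((hsh s).disjoint n) (mem_range_self k) (node_cons n s ▸ hk)
  have hVV : ∀ s m n y, y ∈ node (m :: s) → y ∈ node (n :: s) → m = n := by
    intro s m n y hm hn
    by_contra hmn
    exact disjoint_left.1 ((hsh s).pairwise hmn) (node_cons m s ▸ hm) (node_cons n s ▸ hn)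
  -- the coordinates of a point
  have hr : ∀ (y : Y) (s : List ℕ), ∃ z : K × ℝ, (y ∉ node s → z = (p 0, -1)) ∧
      (∀ k, y = h (node s) k → z = (k, 0)) ∧
      ∀ n, y ∈ node (n :: s) → z = (p n, 1 / ((n : ℝ) + 1)) := by
    intro y s
    rcases em (y ∈ node s) with hy | hy
    · rcases hcases s y hy with ⟨k, rfl⟩ | ⟨n, hn⟩
      · exact ⟨(k, 0), fun h => absurd hy h, fun k' hk' => by rw [(hsh s).injective hk'],
          fun n hn => absurd hn (hhV_disj s k n)⟩
      · exact ⟨(p n, 1 / ((n : ℝ) + 1)), fun h => absurd hy h, fun k hk => absurd (hk ▸ hn) (hhV_disj s k n),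
          fun m hm => by rw [hVV s n m y hn hm]⟩
    · exact ⟨_, fun _ => rfl, fun k hk => absurd (hk ▸ hhsub s k) hy,
        fun n hn => absurd (hVsub s n hn) hy⟩
  choose r r_off r_h r_V using hr
  have hpos : ∀ n : ℕ, (0 : ℝ) < 1 / ((n : ℝ) + 1) := fun n => Nat.one_div_pos_of_nat
  have r_nonneg : ∀ y s, 0 ≤ (r y s).2 ↔ y ∈ node s := by
    intro y s
    refine ⟨fun h0 => by_contra fun hy => ?_, fun hy => ?_⟩
    · rw [r_off y s hy] at h0
      norm_num at h0
    · rcases hcases s y hy with ⟨k, hk⟩ | ⟨n, hn⟩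
      · rw [r_h y s k hk.symm]
      · rw [r_V y s n hn]; exact (hpos n).le
  have r_eq_h : ∀ y s k, r y s = (k, 0) → y = h (node s) k := by
    intro y s k hk
    rcases hcases s y ((r_nonneg y s).1 (by rw [hk])) with ⟨k', hk'⟩ | ⟨n, hn⟩
    · have := r_h y s k' hk'.symm
      rw [hk, Prod.mk.injEq] at this
      rw [this.1, hk']
    · have := r_V y s n hn
      rw [hk, Prod.mk.injEq] at this
      exact absurd this.2 (hpos n).ne
  have r_eq_V : ∀ y s n, r y s = (p n, 1 / ((n : ℝ) + 1)) → y ∈ node (n :: s) := by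
    intro y s n hn
    rcases hcases s y ((r_nonneg y s).1 (by rw [hn]; exact (hpos n).le)) with ⟨k', hk'⟩ | ⟨m, hm⟩
    · have := r_h y s k' hk'.symm
      rw [hn, Prod.mk.injEq] at this
      exact absurd this.2 (hpos n).ne'
    · have := r_V y s m hm
      rw [hn, Prod.mk.injEq] at this
      rwa [one_div_nat_add_one_inj this.2]
  have r_mem : ∀ y, r y ∈ treeModel p := by
    intro y
    refine ⟨(r_nonneg y []).2 (node_nil y), fun s => ⟨fun h0 => ?_, fun h0 => ?_, fun n => ?_⟩⟩
    · rcases hcases s y ((r_nonneg y s).1 h0) with ⟨k, hk⟩ | ⟨n, hn⟩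
      · exact Or.inl (by rw [r_h y s k hk.symm])
      · exact Or.inr ⟨n, r_V y s n hn⟩
    · exact r_off y s fun hy => h0 ((r_nonneg y s).2 hy)
    · rw [r_nonneg]
      exact ⟨r_V y s n, r_eq_V y s n⟩
  have hcont : Continuous r := by
    refine continuous_pi fun s => continuous_iff_continuousAt.2 fun y => ?_
    rcases em (y ∈ node s) with hy | hy
    · rcases hcases s y hy with ⟨k, hk⟩ | ⟨n, hn⟩
      · rw [Metric.continuousAt_iff']
        intro ε hε
        rw [r_h y s k hk.symm]
        obtain ⟨δ, hδ, hδε⟩ := exists_dist_lt_of_injective (hsh s).continuous (hsh s).injective hε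
        have h1 := (hsh s).shadow (δ / 2) (half_pos hδ)
        have h2 := (tendsto_order.1 (tendsto_one_div_add_atTop_nhds_zero_nat (𝕜 := ℝ))).2 ε hε
        obtain ⟨N, hN⟩ := eventually_atTop.1 (h1.and h2)
        -- The delicate case is a point on the copy of `K`. Nearby points avoid the first `N`
        -- subpieces, and the later ones have small height and lie close to their base points `p n`.
        have h3 : ∀ᶠ z in 𝓝 y, ∀ n ∈ Iio N, z ∉ node (n :: s) := by
          refine (eventually_all_finite (finite_Iio N)).2 fun n _ => ?_
          exact (hcl _).compl.isOpen.mem_nhds fun hn => hhV_disj s k n (hk ▸ hn)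
        filter_upwards [h3, (hcl s).isOpen.mem_nhds hy, Metric.ball_mem_nhds y (half_pos hδ)]
          with z hz3 hzs hzy
        rw [Metric.mem_ball] at hzy
        rcases hcases s z hzs with ⟨k', hk'⟩ | ⟨n, hn⟩
        · rw [r_h z s k' hk'.symm, Prod.dist_eq, dist_self, max_eq_left dist_nonneg]
          refine hδε _ _ ?_
          rw [hk, hk']
          linarith
        · rw [r_V z s n hn, Prod.dist_eq]
          have hnN : N ≤ n := not_lt.1 fun hlt => hz3 n hlt hn
          obtain ⟨h4, h5⟩ := hN n hnN
          refine max_lt (hδε _ _ ?_) ?_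
          · have h6 := h4 z (node_cons n s ▸ hn)
            rw [dist_comm] at h6
            rw [hk]
            linarith [dist_triangle (h (node s) (p n)) z y]
          · rwa [Real.dist_eq, sub_zero, abs_of_pos (hpos n)]
      · refine ContinuousAt.congr (f := fun _ => (p n, 1 / ((n : ℝ) + 1))) continuousAt_const ?_
        filter_upwards [(hcl _).isOpen.mem_nhds hn] with z hz
        exact (r_V z s n hz).symm
    · refine ContinuousAt.congr (f := fun _ => (p 0, (-1 : ℝ))) continuousAt_const ?_
      filter_upwards [(hcl s).compl.isOpen.mem_nhds hy] with z hz
      exact (r_off z s hz).symm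
  have hinj : Function.Injective r := by
    intro y y' hyy
    by_contra hne
    have hstep : ∀ s, y ∈ node s → ∃ n, y ∈ node (n :: s) := by
      intro s hy
      refine (hcases s y hy).resolve_left ?_
      rintro ⟨k, hk⟩
      refine hne (hk.symm.trans (r_eq_h y' s k ?_).symm)
      rw [← hyy, r_h y s k hk.symm]
    choose! g hg using hstep
    let b : ℕ → List ℕ := fun n => Nat.rec [] (fun _ s => g s :: s) n
    have hb : ∀ n, y ∈ node (b n) := by
      intro n
      induction n with
      | zero => exact node_nil y
      | succ n ih => exact hg _ ih
    -- Two points with equal coordinates off every copy of `K` lie in a common infinite chain of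
    -- nodes. The chain is strict, since each node contains its copy of `K` and its children do not,
    -- so infinitely many members have diameter at least `dist y y'`.
    have hanti : StrictAnti fun n => node (b n) := by
      refine strictAnti_nat_of_succ_lt fun n => ?_
      refine LE.le.ssubset_of_not_superset (hVsub (b n) (g (b n))) fun hsub => ?_
      exact hhV_disj (b n) (p 0) _ (hsub (hhsub _ _))
    refine infinite_range_of_injective hanti.injective
      ((h𝒰.finite_diam (dist y y') (dist_pos.2 hne)).subset ?_)
    rintro _ ⟨n, rfl⟩
    refine ⟨hnode _, Metric.dist_le_diam_of_mem (Bornology.IsBounded.all _) (hb n) ?_⟩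
    rw [← r_nonneg, ← hyy, r_nonneg]
    exact hb n
  have hsurj : ∀ x ∈ treeModel p, ∃ y, r y = x := by
    rintro x ⟨hx0, hx⟩
    -- the set of points of `Y` compatible with `x` at `s`
    let C : List ℕ → Set Y := fun s =>
      {y | 0 ≤ (x s).2 → y ∈ node s ∧ ∀ k, x s = (k, 0) → y = h (node s) k}
    have hclosed : ∀ s, IsClosed (C s) := by
      intro s
      by_cases h0 : 0 ≤ (x s).2
      · simp only [C, h0, true_imp_iff, ofPred_and]
        refine (hcl s).isClosed.inter ?_
        simp only [ofPred_forall]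
        exact isClosed_iInter fun k => isClosed_iInter fun _ => isClosed_singleton
      · simp only [C, h0, false_imp_iff, ofPred_true, isClosed_univ]
    -- The nodes where `x` has nonnegative height form a single branch.
    have huniq : ∀ s s' : List ℕ, s.length = s'.length → 0 ≤ (x s).2 → 0 ≤ (x s').2 → s = s' := by
      intro s
      induction s with
      | nil => intro s' hs' _ _; exact (List.length_eq_zero_iff.1 hs'.symm).symm
      | cons n s ih =>
        rintro (_ | ⟨m, s'⟩) hlen h1 h2
        · simp at hlen
        · rw [(hx s).2.2 n] at h1
          rw [(hx s').2.2 m] at h2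
          have : s = s' := ih s' (by simpa using hlen) (by rw [h1]; exact (hpos n).le)
            (by rw [h2]; exact (hpos m).le)
          subst this
          rw [h1, Prod.mk.injEq] at h2
          rw [one_div_nat_add_one_inj h2.2]
    -- All constraints up to depth `N` follow from the one at the deepest active node, which lies at
    -- depth `N` unless the branch ended earlier on a copy of `K`. This supplies the nonempty nested
    -- closed sets for the compactness argument.
    have hD : ∀ N : ℕ, ∃ s, s.length ≤ N ∧ 0 ≤ (x s).2 ∧ (s.length = N ∨ (x s).2 = 0) ∧
        C s ⊆ ⋂ (s') (_ : s'.length ≤ N), C s' := by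
      intro N
      induction N with
      | zero =>
        refine ⟨[], le_rfl, hx0, Or.inl rfl, ?_⟩
        refine subset_iInter₂ fun s' hs' => ?_
        rw [List.length_eq_zero_iff.1 (Nat.le_zero.1 hs')]
      | succ N ih =>
        obtain ⟨s, hsN, hs0, hs, hsub⟩ := ih
        by_cases hterm : (x s).2 = 0
        · refine ⟨s, hsN.trans N.le_succ, hs0, Or.inr hterm, ?_⟩
          refine subset_iInter₂ fun s' hs' => ?_
          rcases Nat.lt_or_ge N s'.length with hlt | hle
          · intro y _ h0
            exfalso
            -- no sequence of length `N + 1` is compatible with `x`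
            have hterm' : ∀ s' : List ℕ, s.length < s'.length → ¬ 0 ≤ (x s').2 := by
              intro s'
              induction s' with
              | nil => simp
              | cons n s' ih' =>
                intro hlt h0
                rw [(hx s').2.2 n] at h0
                have h0' : 0 ≤ (x s').2 := by rw [h0]; exact (hpos n).le
                rcases Nat.lt_or_ge s.length s'.length with hlt' | hle'
                · exact ih' hlt' h0'
                · have : s = s' := huniq s s' (by simp at hlt; omega) hs0 h0'
                  subst this
                  rw [h0] at hterm
                  exact (hpos n).ne' hterm
            exact hterm' s' (hsN.trans_lt hlt) h0
          · exact hsub.trans (iInter₂_subset s' hle)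
        · have hslen : s.length = N := hs.resolve_right hterm
          obtain ⟨n, hn⟩ := ((hx s).1 hs0).resolve_left hterm
          have hn0 : 0 ≤ (x (n :: s)).2 := ((hx s).2.2 n).2 hn
          have hCs : C (n :: s) ⊆ C s := by
            intro y hy _
            refine ⟨hVsub s n (hy hn0).1, fun k hk => ?_⟩
            rw [hn, Prod.mk.injEq] at hk
            exact absurd hk.2 (hpos n).ne'
          refine ⟨n :: s, by simp [hslen], hn0, Or.inl (by simp [hslen]), ?_⟩
          refine subset_iInter₂ fun s' hs' => ?_
          rcases Nat.lt_or_ge N s'.length with hlt | hle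
          · by_cases h0 : 0 ≤ (x s').2
            · rw [huniq (n :: s) s' (by simp [hslen]; omega) hn0 h0]
            · intro y _ h
              exact absurd h h0
          · exact (hCs.trans hsub).trans (iInter₂_subset s' hle)
    have hCne : ∀ s, 0 ≤ (x s).2 → (C s).Nonempty := by
      intro s h0
      refine ⟨h (node s) (x s).1, fun _ => ⟨hhsub _ _, fun k hk => by rw [hk]⟩⟩
    obtain ⟨y, hy⟩ := IsCompact.nonempty_iInter_of_sequence_nonempty_isCompact_isClosed
      (fun N => ⋂ (s' : List ℕ) (_ : s'.length ≤ N), C s')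
      (fun N => iInter₂_mono' fun s' hs' => ⟨s', hs'.trans N.le_succ, Subset.rfl⟩)
      (fun N => by
        obtain ⟨s, -, h0, -, hs⟩ := hD N
        exact (hCne s h0).mono hs)
      (isClosed_iInter fun _ => isClosed_iInter fun _ => hclosed _).isCompact
      (fun N => isClosed_iInter fun _ => isClosed_iInter fun _ => hclosed _)
    have hyC : ∀ s, y ∈ C s := fun s => mem_iInter₂.1 (mem_iInter.1 hy s.length) s le_rfl
    refine ⟨y, funext fun s => ?_⟩
    have hact : ∀ s, 0 ≤ (x s).2 → r y s = x s := by
      intro s h0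
      rcases (hx s).1 h0 with h1 | ⟨n, hn⟩
      · have h2 : x s = ((x s).1, 0) := Prod.ext rfl h1
        rw [h2]
        exact r_h y s _ ((hyC s h0).2 _ h2)
      · rw [hn]
        exact r_V y s n (hyC (n :: s) (((hx s).2.2 n).2 hn)).1
    induction s with
    | nil => exact hact [] hx0
    | cons n s ih =>
      by_cases h0 : 0 ≤ (x (n :: s)).2
      · exact hact _ h0
      · rw [(hx _).2.1 h0]
        refine r_off y _ fun hyn => h0 ?_
        rw [(hx s).2.2 n, ← ih]
        exact r_V y s n hyn
  let F : Y → treeModel p := fun y => ⟨r y, r_mem y⟩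
  have hF : Function.Bijective F :=
    ⟨fun y z hyz => hinj (congrArg Subtype.val hyz), fun x =>
      (hsurj x.1 x.2).imp fun y hy => Subtype.ext hy⟩
  exact ⟨Continuous.homeoOfEquivCompactToT2 (f := Equiv.ofBijective F hF)
    (hcont.subtype_mk r_mem)⟩

/-- Unpairing the index repeats every term of a dense sequence infinitely often, so isolated points
are cluster points too. -/
theorem exists_mapClusterPt_forall (K : Type*) [TopologicalSpace K] [Nonempty K]
    [TopologicalSpace.SeparableSpace K] : ∃ p : ℕ → K, ∀ k, MapClusterPt k atTop p := by
  refine ⟨fun n => TopologicalSpace.denseSeq K (Nat.unpair n).1, fun k => ?_⟩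
  rw [mapClusterPt_iff_frequently]
  intro s hs
  obtain ⟨W, hWs, hWo, hkW⟩ := mem_nhds_iff.1 hs
  obtain ⟨_, hmW, ⟨m, rfl⟩⟩ :=
    (TopologicalSpace.denseRange_denseSeq K).inter_open_nonempty W hWo ⟨k, hkW⟩
  rw [frequently_atTop]
  exact fun N => ⟨Nat.pair m N, Nat.right_le_pair m N, hWs (by simpa using hmW)⟩

/-- Compact metric spaces with a tree of pieces homeomorphic to `K` are homeomorphic. -/
theorem IsPieceTree.nonempty_homeomorph [Nonempty K] (h𝒰 : IsPieceTree K 𝒰) {Y' : Type*}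
    [MetricSpace Y'] [CompactSpace Y'] {𝒰' : Set (Set Y')} (h𝒰' : IsPieceTree K 𝒰') :
    Nonempty (Y ≃ₜ Y') := by
  obtain ⟨p, hp⟩ := exists_mapClusterPt_forall K
  obtain ⟨e⟩ := h𝒰.nonempty_homeomorph_treeModel hp
  obtain ⟨e'⟩ := h𝒰'.nonempty_homeomorph_treeModel hp
  exact ⟨e.trans e'.symm⟩

end TreeModel

open UniformSpace

/-! ### Limit sets in the remainder of a completion. -/

section Remainder

/-- The complement of a uniform space in its completion. -/
def completionRemainder (X : Type*) [UniformSpace X] : Set (Completion X) :=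
  (range ((↑) : X → Completion X))ᶜ

/-- The points of the remainder of the completion that lie in the closure of `H`. -/
def limitSet {X : Type*} [UniformSpace X] (H : Set X) : Set (completionRemainder X) :=
  {ξ | (ξ : Completion X) ∈ closure ((↑) '' H)}

variable {X : Type*} [PseudoMetricSpace X]

theorem mem_limitSet_iff {H : Set X} {ξ : completionRemainder X} :
    ξ ∈ limitSet H ↔ ∀ ε > 0, ∃ x ∈ H, dist (ξ : Completion X) x < ε := by
  simp [limitSet, Metric.mem_closure_iff]

theorem limitSet_mono {H H' : Set X} (h : H ⊆ H') : limitSet H ⊆ limitSet H' :=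
  fun _ hξ => closure_mono (image_mono h) hξ

theorem limitSet_univ : limitSet (univ : Set X) = univ := by
  ext ξ
  simp only [limitSet, image_univ, mem_univ, iff_true]
  exact Completion.denseRange_coe _

theorem limitSet_union (H H' : Set X) : limitSet (H ∪ H') = limitSet H ∪ limitSet H' := by
  ext ξ
  simp [limitSet, image_union, closure_union]

theorem limitSet_eq_empty {H : Set X} (hH : H.Finite) : limitSet H = ∅ := by
  ext ξ
  simp only [limitSet, mem_ofPred_eq, mem_empty_iff_false, iff_false]
  rw [(hH.image _).isClosed.closure_eq]
  rintro ⟨x, -, hx⟩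
  exact ξ.2 ⟨x, hx⟩

theorem limitSet_union_of_finite (H : Set X) {H' : Set X} (hH' : H'.Finite) :
    limitSet (H ∪ H') = limitSet H := by
  rw [limitSet_union, limitSet_eq_empty hH', union_empty]

theorem isClosed_limitSet (H : Set X) : IsClosed (limitSet H) :=
  isClosed_closure.preimage continuous_subtype_val

theorem limitSet_biUnion {ι : Type*} {s : Set ι} (hs : s.Finite) (H : ι → Set X) :
    limitSet (⋃ i ∈ s, H i) = ⋃ i ∈ s, limitSet (H i) := by
  ext ξ
  simp [limitSet, image_iUnion₂, hs.closure_biUnion]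

theorem dist_le_of_mem_limitSet {H : Set X} {D : ℝ} (hD : ∀ x ∈ H, ∀ y ∈ H, dist x y ≤ D)
    {ξ η : completionRemainder X} (hξ : ξ ∈ limitSet H) (hη : η ∈ limitSet H) : dist ξ η ≤ D := by
  refine le_of_forall_pos_le_add fun ε hε => ?_
  obtain ⟨x, hx, hx'⟩ := mem_limitSet_iff.1 hξ (ε / 2) (half_pos hε)
  obtain ⟨y, hy, hy'⟩ := mem_limitSet_iff.1 hη (ε / 2) (half_pos hε)
  have h1 := hD x hx y hy
  rw [← Completion.dist_eq] at h1
  rw [dist_comm] at hy'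
  have h2 := dist_triangle4 (ξ : Completion X) x y η
  rw [Subtype.dist_eq]
  linarith

/-- Limit sets of sets at positive distance from each other are disjoint. -/
theorem disjoint_limitSet {H H' : Set X} {δ : ℝ} (hδ : 0 < δ)
    (h : ∀ x ∈ H, ∀ y ∈ H', δ ≤ dist x y) : Disjoint (limitSet H) (limitSet H') := by
  refine disjoint_left.2 fun ξ hξ hξ' => ?_
  obtain ⟨x, hx, hx'⟩ := mem_limitSet_iff.1 hξ (δ / 2) (half_pos hδ)
  obtain ⟨y, hy, hy'⟩ := mem_limitSet_iff.1 hξ' (δ / 2) (half_pos hδ)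
  have h1 := h x hx y hy
  rw [← Completion.dist_eq] at h1
  linarith [dist_triangle_left (x : Completion X) y ξ]

theorem limitSet_compl {H : Set X} {δ : ℝ} (hδ : 0 < δ)
    (h : ∀ x ∈ H, ∀ y ∈ Hᶜ, δ ≤ dist x y) : limitSet Hᶜ = (limitSet H)ᶜ := by
  refine (IsCompl.compl_eq ⟨disjoint_limitSet hδ h, codisjoint_iff.2 ?_⟩).symm
  exact (limitSet_union _ _).symm.trans (by rw [union_compl_self, limitSet_univ]; rfl)

theorem isClopen_limitSet {H : Set X} {δ : ℝ} (hδ : 0 < δ)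
    (h : ∀ x ∈ H, ∀ y ∈ Hᶜ, δ ≤ dist x y) : IsClopen (limitSet H) :=
  ⟨isClosed_limitSet H, isClosed_compl_iff.1 (limitSet_compl hδ h ▸ isClosed_limitSet _)⟩

/-- A small ball around `x` contains no other point of the dense subset `X`, hence no other point at
all. This makes the remainder closed. -/
theorem isOpen_singleton_completion_coe [DiscreteTopology X] (x : X) :
    IsOpen {(x : Completion X)} := by
  obtain ⟨ε, hε, hx⟩ := Metric.isOpen_iff.1 (isOpen_discrete ({x} : Set X)) x rfl
  rw [Metric.isOpen_iff]
  rintro _ rfl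
  refine ⟨ε, hε, fun ξ hξ => ?_⟩
  have h1 : ξ ∈ closure (Metric.ball (x : Completion X) ε ∩ range ((↑) : X → Completion X)) := by
    exact Completion.denseRange_coe.open_subset_closure_inter Metric.isOpen_ball hξ
  have h2 : Metric.ball (x : Completion X) ε ∩ range ((↑) : X → Completion X) ⊆ {(x : Completion X)} := by
    rintro _ ⟨hy, y, rfl⟩
    rw [Metric.mem_ball, Completion.dist_eq] at hy
    rw [hx hy]
    rfl
  simpa using closure_mono h2 h1

theorem isClosed_completionRemainder [DiscreteTopology X] : IsClosed (completionRemainder X) := by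
  refine isClosed_compl_iff.2 ?_
  rw [← iUnion_singleton_eq_range]
  exact isOpen_iUnion isOpen_singleton_completion_coe

theorem compactSpace_completion (h : TotallyBounded (univ : Set X)) :
    CompactSpace (Completion X) := by
  refine ⟨isCompact_iff_totallyBounded_isComplete.2 ⟨?_, isComplete_univ⟩⟩
  have := (h.image (Completion.uniformContinuous_coe X)).closure
  rwa [image_univ, Completion.denseRange_coe.closure_range] at this

variable [DiscreteTopology X] [CompactSpace (Completion X)]

instance : CompactSpace (completionRemainder X) :=
  isCompact_iff_compactSpace.1 isClosed_completionRemainder.isCompact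

theorem limitSet_nonempty {H : Set X} (hH : H.Infinite) : (limitSet H).Nonempty := by
  have hinj : Function.Injective ((↑) : X → Completion X) := Completion.coe_injective X
  obtain ⟨ξ, hξ⟩ := (hH.image hinj.injOn).exists_accPt_principal
  have hcl : ξ ∈ closure (((↑) : X → Completion X) '' H) := by
    exact mem_closure_iff_clusterPt.2 hξ.clusterPt
  refine ⟨⟨ξ, ?_⟩, hcl⟩
  rintro ⟨x, rfl⟩
  obtain ⟨y, ⟨hy, -⟩, hyx⟩ := accPt_iff_nhds.1 hξ _ ((isOpen_singleton_completion_coe x).mem_nhds rfl)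
  exact hyx hy

variable {X' : Type*} [PseudoMetricSpace X'] [DiscreteTopology X']

omit [DiscreteTopology X] in
-- The extension to completions is injective with closed range. It maps remainder to remainder
-- because points of `X'` are isolated: the preimage of such a point is open, so if nonempty it
-- contains a point of `X`, and by injectivity nothing else.
theorem exists_embedding_range_eq_limitSet {φ : X → X'} (hφ : IsUniformInducing φ) :
    ∃ h : completionRemainder X → completionRemainder X', Continuous h ∧ Function.Injective h ∧
      range h = limitSet (range φ) := by
  let j : Completion X → Completion X' := Completion.extension fun x => (φ x : Completion X')
  have hu : IsUniformInducing fun x => (φ x : Completion X') :=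
    (Completion.isUniformInducing_coe X').comp hφ
  have hj : IsUniformInducing j := Completion.isUniformInducing_extension hu
  have hjc : Continuous j := hj.uniformContinuous.continuous
  have hji : Function.Injective j := hj.isUniformEmbedding.injective
  have hj_coe : ∀ x : X, j x = φ x := fun x => Completion.extension_coe hu.uniformContinuous x
  have hrange : j '' range ((↑) : X → Completion X) = (↑) '' range φ := by
    rw [← range_comp, ← range_comp]
    exact congrArg range (funext hj_coe)
  have hmem : ∀ ξ : completionRemainder X, j ξ ∈ completionRemainder X' := by
    rintro ⟨ξ, hξ⟩ ⟨x', hx'⟩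
    obtain ⟨_, hx, ⟨x, rfl⟩⟩ := Completion.denseRange_coe.inter_open_nonempty _
      ((isOpen_singleton_completion_coe x').preimage hjc) ⟨ξ, hx'.symm⟩
    exact hξ ⟨x, hji (hx.trans hx')⟩
  refine ⟨fun ξ => ⟨j ξ, hmem ξ⟩, (hjc.comp continuous_subtype_val).subtype_mk _,
    fun ξ η h => Subtype.ext (hji (congrArg Subtype.val h)), ?_⟩
  ext ξ'
  constructor
  · rintro ⟨ξ, rfl⟩
    change j ξ ∈ closure _
    rw [← hrange]
    exact image_closure_subset_closure_image hjc (mem_image_of_mem j (Completion.denseRange_coe _))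
  · intro hξ'
    have h1 : closure (((↑) : X' → Completion X') '' range φ) ⊆ range j :=
      closure_minimal (hrange ▸ image_subset_range _ _) (hjc.isClosedMap.isClosed_range)
    obtain ⟨ξ, hξ⟩ := h1 hξ'
    refine ⟨⟨ξ, ?_⟩, Subtype.ext hξ⟩
    rintro ⟨x, rfl⟩
    exact ξ'.2 ⟨φ x, by rw [← hξ, hj_coe]⟩

theorem nonempty_homeomorph_completionRemainder {φ : X → X'} (hφ : IsUniformInducing φ)
    (hs : Function.Surjective φ) :
    Nonempty (completionRemainder X ≃ₜ completionRemainder X') := by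
  obtain ⟨h, hc, hi, hr⟩ := exists_embedding_range_eq_limitSet hφ
  rw [hs.range_eq, limitSet_univ, range_eq_univ] at hr
  exact ⟨Continuous.homeoOfEquivCompactToT2 (f := Equiv.ofBijective h ⟨hi, hr⟩) hc⟩

end Remainder

open scoped NNReal Pointwise

/-! ### Estimates for Floyd functions. -/

section FloydFunction

variable {f : ℕ → ℝ}

theorem IsFloydFunction.antitone' (hf : IsFloydFunction f) : Antitone f := by
  refine antitone_nat_of_succ_le fun n => ?_
  rcases n with _ | n
  · exact hf.zero_eq.ge
  · exact hf.antitone _ n.succ_pos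

theorem IsFloydFunction.pos' (hf : IsFloydFunction f) (n : ℕ) : 0 < f n := by
  rcases n with _ | n
  · rw [hf.zero_eq]; exact hf.pos 1 le_rfl
  · exact hf.pos _ n.succ_pos

theorem IsFloydFunction.exists_le_mul_add (hf : IsFloydFunction f) (m : ℕ) :
    ∃ C : ℝ≥0, ∀ n, ENNReal.ofReal (f n) ≤ C * ENNReal.ofReal (f (n + m)) := by
  obtain ⟨c, hc, hcf⟩ := hf.decay
  have hone : ∃ C : ℝ≥0, ∀ n, ENNReal.ofReal (f n) ≤ C * ENNReal.ofReal (f (n + 1)) := by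
    -- The `1` serves the index `0`, where `f 0 = f 1`.
    refine ⟨max 1 (Real.toNNReal c⁻¹), fun n => ?_⟩
    rcases n with _ | n
    · rw [hf.zero_eq]
      exact le_mul_of_one_le_left' (by simp)
    · calc ENNReal.ofReal (f (n + 1)) ≤ ENNReal.ofReal (c⁻¹ * f (n + 1 + 1)) := by
            refine ENNReal.ofReal_le_ofReal ?_
            rw [← div_eq_inv_mul, le_div_iff₀' hc]
            exact hcf _ n.succ_pos
        _ = Real.toNNReal c⁻¹ * ENNReal.ofReal (f (n + 1 + 1)) :=
            ENNReal.ofReal_mul (inv_pos.2 hc).le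
        _ ≤ _ := by gcongr; exact le_max_right _ _
  obtain ⟨C, hC⟩ := hone
  refine ⟨C ^ m, fun n => ?_⟩
  induction m with
  | zero => simp
  | succ m ih =>
    refine ih.trans ?_
    calc _ ≤ ((C ^ m : ℝ≥0) : ℝ≥0∞) * (C * ENNReal.ofReal (f (n + m + 1))) := by gcongr; exact hC _
      _ = _ := by rw [pow_succ, ENNReal.coe_mul, mul_assoc, ← add_assoc]

/-- Bounded additive changes of word length cost only a constant factor; the Lipschitz bounds for
maps between Floyd spaces rest on this. -/
theorem IsFloydFunction.exists_le_mul (hf : IsFloydFunction f) (m : ℕ) :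
    ∃ C : ℝ≥0, ∀ a b, a ≤ b + m → ENNReal.ofReal (f b) ≤ C * ENNReal.ofReal (f a) := by
  obtain ⟨C, hC⟩ := hf.exists_le_mul_add m
  refine ⟨C, fun a b hab => (hC b).trans ?_⟩
  gcongr
  exact hf.antitone' hab

theorem IsFloydFunction.exists_sum_Ico_le (hf : IsFloydFunction f) {ε : ℝ} (hε : 0 < ε) :
    ∃ N, ∀ a b, N ≤ a → ∑ j ∈ Finset.Ico a b, ENNReal.ofReal (f j) ≤ ENNReal.ofReal ε := by
  have h := tendsto_sum_nat_add f
  obtain ⟨N, hN⟩ := eventually_atTop.1 ((tendsto_order.1 h).2 ε hε)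
  refine ⟨N, fun a b ha => ?_⟩
  rw [← ENNReal.ofReal_sum_of_nonneg fun j _ => (hf.pos' j).le]
  refine ENNReal.ofReal_le_ofReal ((?_ : _ ≤ ∑' k, f (k + a)).trans (hN a ha).le)
  rw [Finset.sum_Ico_eq_sum_range]
  simp_rw [add_comm a]
  exact ((summable_nat_add_iff a).2 hf.summable).sum_le_tsum _ fun j _ => (hf.pos' _).le

theorem IsFloydFunction.exists_mul_le (hf : IsFloydFunction f) (c : ℕ) {ε : ℝ} (hε : 0 < ε) :
    ∃ N, ∀ a, N ≤ a → c * ENNReal.ofReal (f a) ≤ ENNReal.ofReal ε := by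
  have h := hf.summable.tendsto_atTop_zero.const_mul (c : ℝ)
  rw [mul_zero] at h
  obtain ⟨N, hN⟩ := eventually_atTop.1 ((tendsto_order.1 h).2 ε hε)
  refine ⟨N, fun a ha => ?_⟩
  rw [← ENNReal.ofReal_natCast, ← ENNReal.ofReal_mul (Nat.cast_nonneg _)]
  exact ENNReal.ofReal_le_ofReal (hN a ha).le

end FloydFunction

/-! ### Word length and geodesics in Cayley graphs. -/

section WordLength

open SimpleGraph

variable {G : Type*} [Group G] {S : Set G}

/-- The word length of `g` with respect to `S`. -/
noncomputable def wordLength (S : Set G) (g : G) : ℕ :=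
  (mulCayley S).dist 1 g

theorem mulCayley_adj_mul {x s : G} (hs : s ∈ S ∨ s⁻¹ ∈ S) (hne : s ≠ 1) :
    (mulCayley S).Adj x (x * s) := by
  rw [mulCayley_adj]
  refine ⟨fun h => hne (by simpa using h.symm), ?_⟩
  simpa using hs

theorem exists_mul_of_mulCayley_adj {x y : G} (h : (mulCayley S).Adj x y) :
    ∃ s, (s ∈ S ∨ s⁻¹ ∈ S) ∧ y = x * s := by
  rw [mulCayley_adj] at h
  exact ⟨x⁻¹ * y, by simpa using h.2, by simp⟩

theorem mulCayley_reachable_mul (hS : Subgroup.closure S = ⊤) (x g : G) :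
    (mulCayley S).Reachable x (x * g) := by
  have hg : g ∈ Subgroup.closure S := hS ▸ Subgroup.mem_top g
  have key : ∀ y s : G, (s ∈ S ∨ s⁻¹ ∈ S) → (mulCayley S).Reachable y (y * s) := by
    intro y s hs
    by_cases h1 : s = 1
    · rw [h1, mul_one]
    · exact (mulCayley_adj_mul hs h1).reachable
  induction hg using Subgroup.closure_induction_right with
  | one => rw [mul_one]
  | mul_right y _ s hs ih => rw [← mul_assoc]; exact ih.trans (key _ _ (Or.inl hs))
  | mul_inv_cancel y _ s hs ih =>
    rw [← mul_assoc]; exact ih.trans (key _ _ (Or.inr (by rwa [inv_inv])))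

theorem mulCayley_connected (hS : Subgroup.closure S = ⊤) : (mulCayley S).Connected where
  preconnected x y := by simpa using mulCayley_reachable_mul hS x (x⁻¹ * y)

theorem mulCayley_dist_mul_left (k x y : G) :
    (mulCayley S).dist (k * x) (k * y) = (mulCayley S).dist x y := by
  have hle : ∀ k x y : G, (mulCayley S).Reachable x y →
      (mulCayley S).Reachable (k * x) (k * y) ∧
      (mulCayley S).dist (k * x) (k * y) ≤ (mulCayley S).dist x y := by
    intro k x y h
    obtain ⟨p, hp⟩ := h.exists_walk_length_eq_dist
    let φ : mulCayley S →g mulCayley S :=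
      ⟨fun g => k * g, fun h => mulCayley_adj_mul_iff_right.2 h⟩
    refine ⟨⟨p.map φ⟩, ?_⟩
    rw [← hp, ← p.length_map φ]
    exact dist_le _
  by_cases h : (mulCayley S).Reachable x y
  · refine le_antisymm (hle k x y h).2 ?_
    have := (hle k⁻¹ _ _ (hle k x y h).1).2
    simpa using this
  · rw [dist_eq_zero_of_not_reachable h, dist_eq_zero_of_not_reachable]
    intro h'
    exact h (by simpa using (hle k⁻¹ _ _ h').1)

theorem mulCayley_dist_mul_right (x g : G) : (mulCayley S).dist x (x * g) = wordLength S g := by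
  rw [wordLength, ← mulCayley_dist_mul_left x 1 g, mul_one]

theorem wordLength_one : wordLength S (1 : G) = 0 := dist_self

theorem wordLength_mul_le (hS : Subgroup.closure S = ⊤) (x g : G) :
    wordLength S (x * g) ≤ wordLength S x + wordLength S g := by
  rw [← mulCayley_dist_mul_right x g]
  exact (mulCayley_connected hS).dist_triangle

theorem wordLength_inv (g : G) : wordLength S g⁻¹ = wordLength S g := by
  rw [← mulCayley_dist_mul_right g g⁻¹, mul_inv_cancel, dist_comm, wordLength]

theorem wordLength_le_mul_add (hS : Subgroup.closure S = ⊤) (x g : G) :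
    wordLength S x ≤ wordLength S (x * g) + wordLength S g := by
  simpa [wordLength_inv] using wordLength_mul_le hS (x * g) g⁻¹

theorem wordLength_le_of_adj (hS : Subgroup.closure S = ⊤) {x y : G} (h : (mulCayley S).Adj x y) :
    wordLength S x ≤ wordLength S y + 1 := by
  rw [← dist_eq_one_iff_adj.2 h.symm]
  exact (mulCayley_connected hS).dist_triangle

theorem exists_adj_dist_eq (hS : Subgroup.closure S = ⊤) {x y : G} {n : ℕ}
    (h : (mulCayley S).dist x y = n + 1) :
    ∃ z, (mulCayley S).Adj z y ∧ (mulCayley S).dist x z = n := by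
  obtain ⟨p, hp⟩ := (mulCayley_connected hS).exists_walk_length_eq_dist y x
  rw [dist_comm, h] at hp
  cases p with
  | nil => simp at hp
  | @cons _ z _ hadj q =>
    refine ⟨z, hadj.symm, le_antisymm ?_ ?_⟩
    · rw [dist_comm]
      refine (dist_le q).trans ?_
      simpa using hp.le
    · have := (mulCayley_connected hS).dist_triangle (u := x) (v := z) (w := y)
      rw [h, dist_eq_one_iff_adj.2 hadj.symm] at this
      omega

theorem finite_wordLength_le (hS : IsFiniteGenSet S) (n : ℕ) : {g | wordLength S g ≤ n}.Finite := by
  induction n with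
  | zero =>
    refine (finite_singleton (1 : G)).subset fun g hg => ?_
    exact (((mulCayley_connected hS.2).dist_eq_zero_iff).1 (Nat.le_zero.1 hg)).symm
  | succ n ih =>
    refine (ih.union (ih.image2 (fun x s => x * s) (hS.1.union hS.1.inv))).subset fun g hg => ?_
    rcases Nat.lt_or_ge n (wordLength S g) with hlt | hle
    · obtain ⟨z, hz, hdz⟩ := exists_adj_dist_eq hS.2 (le_antisymm hg hlt)
      obtain ⟨s, hs, rfl⟩ := exists_mul_of_mulCayley_adj hz
      exact Or.inr ⟨z, hdz.le, s, hs.imp id id, rfl⟩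
    · exact Or.inl hle

theorem finite_wordLength_mul_le (hS : IsFiniteGenSet S) (n : ℕ) :
    ∃ B : Set G, B.Finite ∧ ∀ g ∉ B, n ≤ wordLength S g :=
  ⟨_, finite_wordLength_le hS n, fun _ hg => (not_le.1 hg).le⟩

end WordLength

/-! ### The Floyd metric and almost invariant sets. -/

section FloydDistance

open SimpleGraph

variable {G : Type*} [Group G] {S : Set G} {f : ℕ → ℝ}

theorem floydEDist_le_of_adj {x y : G} (h : (mulCayley S).Adj x y) :
    floydEDist f S x y ≤ floydEdgeLength f S x y := by
  refine (iInf_le _ h.toWalk).trans ?_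
  simp [floydLength]

theorem floydEdgeLength_le (hf : IsFloydFunction f) {x y : G} {m : ℕ} (hx : m ≤ wordLength S x)
    (hy : m ≤ wordLength S y) : floydEdgeLength f S x y ≤ ENNReal.ofReal (f m) :=
  ENNReal.ofReal_le_ofReal (hf.antitone' (le_min hx hy))

theorem le_floydEdgeLength (hf : IsFloydFunction f) {x y : G} {m : ℕ} (hx : wordLength S x ≤ m) :
    ENNReal.ofReal (f m) ≤ floydEdgeLength f S x y :=
  ENNReal.ofReal_le_ofReal (hf.antitone' ((min_le_left _ _).trans hx))

theorem le_floydEDist_of_ne (hf : IsFloydFunction f) {x y : G} (h : x ≠ y) :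
    ENNReal.ofReal (f (wordLength S x)) ≤ floydEDist f S x y := by
  refine le_iInf fun p => ?_
  cases p with
  | nil => exact absurd rfl h
  | @cons _ z _ hadj q =>
    refine (le_floydEdgeLength hf (y := z) le_rfl).trans ?_
    simp [floydLength]

theorem floydEDist_ne_top (hS : Subgroup.closure S = ⊤) (x y : G) : floydEDist f S x y ≠ ⊤ := by
  obtain ⟨p⟩ := (mulCayley_connected hS).preconnected x y
  refine ne_top_of_le_ne_top ?_ (iInf_le _ p)
  induction p with
  | nil => simp [floydLength]
  | cons h q ih =>
    simp only [floydLength, Walk.darts_cons, List.map_cons, List.sum_cons]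
    exact ENNReal.add_ne_top.2 ⟨ENNReal.ofReal_ne_top, ih⟩

/-- A geodesic of length `n` starting at `x` stays at distance at least `|x| - n` from the identity.
-/
theorem floydEDist_mul_right_le (hS : Subgroup.closure S = ⊤) (hf : IsFloydFunction f) (x g : G) :
    floydEDist f S x (x * g) ≤
      wordLength S g * ENNReal.ofReal (f (wordLength S x - wordLength S g)) := by
  have key : ∀ n y, (mulCayley S).dist x y = n →
      floydEDist f S x y ≤ n * ENNReal.ofReal (f (wordLength S x - n)) := by
    intro n
    induction n with
    | zero =>
      intro y hy
      rw [← (mulCayley_connected hS).dist_eq_zero_iff.1 hy, floydEDist_self]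
      exact zero_le
    | succ n ih =>
      intro y hy
      obtain ⟨z, hzy, hxz⟩ := exists_adj_dist_eq hS hy
      have hw : ∀ w, wordLength S x ≤ wordLength S w + (mulCayley S).dist x w := by
        intro w
        rw [SimpleGraph.dist_comm (u := x)]
        exact (mulCayley_connected hS).dist_triangle
      have h1 := hw y
      have h2 := hw z
      calc floydEDist f S x y ≤ floydEDist f S x z + floydEDist f S z y := floydEDist_triangle _ _ _ _ _
        _ ≤ n * ENNReal.ofReal (f (wordLength S x - (n + 1))) +
            ENNReal.ofReal (f (wordLength S x - (n + 1))) := by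
          refine add_le_add ((ih z hxz).trans ?_) ((floydEDist_le_of_adj hzy).trans
            (floydEdgeLength_le hf (by omega) (by omega)))
          gcongr
          exact hf.antitone' (by omega)
        _ = _ := by push_cast; ring
  exact key _ _ (mulCayley_dist_mul_right x g)

/-- A point of `H` is joined to the frontier of `H` by a geodesic towards the identity. -/
theorem exists_frontier_floydEDist_le (hS : Subgroup.closure S = ⊤) (hf : IsFloydFunction f)
    {H : Set G} (h1 : 1 ∉ H) {x : G} (hx : x ∈ H) :
    ∃ y ∈ H, (∃ z ∉ H, (mulCayley S).Adj y z ∧ wordLength S y = wordLength S z + 1) ∧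
      floydEDist f S y x ≤
        ∑ j ∈ Finset.Ico (wordLength S y) (wordLength S x), ENNReal.ofReal (f j) := by
  have key : ∀ n x, x ∈ H → wordLength S x = n → ∃ y ∈ H, (∃ z ∉ H, (mulCayley S).Adj y z ∧
      wordLength S y = wordLength S z + 1) ∧ wordLength S y ≤ n ∧
      floydEDist f S y x ≤ ∑ j ∈ Finset.Ico (wordLength S y) n, ENNReal.ofReal (f j) := by
    intro n
    induction n with
    | zero =>
      intro x hx h0
      exact absurd ((mulCayley_connected hS).dist_eq_zero_iff.1 h0 ▸ hx) h1
    | succ n ih =>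
      intro x hx hn
      obtain ⟨z, hzx, hz⟩ := exists_adj_dist_eq hS hn
      by_cases hzH : z ∈ H
      · obtain ⟨y, hy, hyz, hyn, hyd⟩ := ih z hzH hz
        refine ⟨y, hy, hyz, hyn.trans n.le_succ, ?_⟩
        rw [Finset.sum_Ico_succ_top hyn]
        refine (floydEDist_triangle f S y z x).trans (add_le_add hyd ?_)
        exact (floydEDist_le_of_adj hzx).trans
          (floydEdgeLength_le hf (m := n) hz.ge (hn ▸ n.le_succ))
      · refine ⟨x, hx, ⟨z, hzH, hzx.symm, hn.trans (congrArg (· + 1) hz.symm)⟩, hn.le, ?_⟩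
        rw [floydEDist_self]
        exact zero_le
  obtain ⟨y, hy, hyz, -, hyd⟩ := key _ x hx rfl
  exact ⟨y, hy, hyz, hyd⟩

theorem floydEDist_map_le (hS : Subgroup.closure S = ⊤) {G' : Type*} [Group G'] {S' : Set G'}
    {f' : ℕ → ℝ} {φ : G → G'} {C : ℝ≥0} (h : ∀ x y, (mulCayley S).Adj x y →
      floydEDist f' S' (φ x) (φ y) ≤ C * floydEdgeLength f S x y) (x y : G) :
    floydEDist f' S' (φ x) (φ y) ≤ C * floydEDist f S x y := by
  have : Nonempty ((mulCayley S).Walk x y) := (mulCayley_connected hS).preconnected x y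
  rw [floydEDist, floydEDist, ENNReal.mul_iInf (by simp)]
  refine le_iInf fun p => (?_ : floydEDist f' S' (φ x) (φ y) ≤ _)
  clear this
  induction p with
  | nil => rw [floydEDist_self]; exact zero_le
  | cons hadj q ih =>
    refine (floydEDist_triangle _ _ _ _ _).trans ((add_le_add (h _ _ hadj) ih).trans ?_)
    simp [floydLength, mul_add]

/-- A subset of a group which every right translation moves only by a finite amount. -/
def IsAlmostInvariant (H : Set G) : Prop :=
  ∀ s : G, {x | ¬ (x ∈ H ↔ x * s ∈ H)}.Finite

theorem isAlmostInvariant_of_closure {H : Set G} (hS : Subgroup.closure S = ⊤)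
    (h : ∀ s ∈ S, {x | ¬ (x ∈ H ↔ x * s ∈ H)}.Finite) : IsAlmostInvariant H := by
  intro s
  have hs : s ∈ Subgroup.closure S := hS ▸ Subgroup.mem_top s
  induction hs using Subgroup.closure_induction with
  | mem s hs => exact h s hs
  | one => simp
  | mul s t _ _ ihs iht =>
    refine (ihs.union (iht.preimage (mul_left_injective s).injOn)).subset fun x hx => ?_
    by_contra hcon
    simp only [mem_union, mem_ofPred_eq, mem_preimage, not_or, not_not] at hcon
    exact hx (by rw [hcon.1, hcon.2, mul_assoc])
  | inv s _ ih =>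
    refine (ih.preimage (mul_left_injective s⁻¹).injOn).subset fun x hx => ?_
    simp only [mem_preimage, mem_ofPred_eq, inv_mul_cancel_right]
    exact fun h => hx h.symm

theorem IsAlmostInvariant.smul {H : Set G} (h : IsAlmostInvariant H) (k : G) :
    IsAlmostInvariant (k • H) := by
  intro s
  refine ((h s).preimage (mul_right_injective k⁻¹).injOn).subset fun x hx => ?_
  simpa [mem_smul_set_iff_inv_smul_mem, mul_assoc] using hx

theorem IsAlmostInvariant.finite_frontier {H : Set G} (h : IsAlmostInvariant H) (hS : S.Finite) :
    {y ∈ H | ∃ z ∉ H, (mulCayley S).Adj y z}.Finite := by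
  refine ((hS.union hS.inv).biUnion fun s _ => h s).subset ?_
  rintro y ⟨hy, z, hz, hyz⟩
  obtain ⟨s, hs, rfl⟩ := exists_mul_of_mulCayley_adj hyz
  exact mem_biUnion (show s ∈ S ∪ S⁻¹ from hs) fun h => hz (h.1 hy)

/-- Every path out of `H` crosses an edge at the finite frontier, and the frontier lies in a ball,
so this edge has length bounded below. -/
theorem IsAlmostInvariant.exists_le_floydEDist {H : Set G} (h : IsAlmostInvariant H)
    (hS : IsFiniteGenSet S) (hf : IsFloydFunction f) :
    ∃ δ : ℝ, 0 < δ ∧ ∀ x ∈ H, ∀ y ∉ H, ENNReal.ofReal δ ≤ floydEDist f S x y := by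
  obtain ⟨m, hm⟩ := ((h.finite_frontier hS.1).image (wordLength S)).bddAbove
  refine ⟨f m, hf.pos' m, fun x hx y hy => le_iInf fun p => ?_⟩
  obtain ⟨d, hd, hd1, hd2⟩ := p.exists_boundary_dart H hx hy
  refine (le_floydEdgeLength hf (y := d.snd) (hm ⟨d.fst, ⟨hd1, d.snd, hd2, d.adj⟩, rfl⟩)).trans ?_
  exact List.single_le_sum (by simp) _ (List.mem_map_of_mem hd)

theorem exists_finite_floydEDist_mul_right_le (hS : IsFiniteGenSet S) (hf : IsFloydFunction f)
    (c : ℕ) {ε : ℝ} (hε : 0 < ε) : ∃ B : Set G, B.Finite ∧ ∀ k ∉ B, ∀ g, wordLength S g ≤ c →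
      floydEDist f S k (k * g) ≤ ENNReal.ofReal ε := by
  obtain ⟨N, hN⟩ := hf.exists_mul_le c hε
  obtain ⟨B, hB, hBN⟩ := finite_wordLength_mul_le hS (N + c)
  refine ⟨B, hB, fun k hk g hg => (floydEDist_mul_right_le hS.2 hf k g).trans ?_⟩
  refine le_trans ?_ (hN (wordLength S k - c) (by have := hBN k hk; omega))
  gcongr
  exact hf.antitone' (by omega)

/-- All but finitely many of the translates of an almost invariant set that do not contain the
identity are small. -/
theorem IsAlmostInvariant.exists_finite_floydEDist_le {H : Set G} (h : IsAlmostInvariant H)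
    (hS : IsFiniteGenSet S) (hf : IsFloydFunction f) {ε : ℝ} (hε : 0 < ε) :
    ∃ B : Set G, B.Finite ∧ ∀ k ∉ B, 1 ∉ k • H → ∀ x ∈ k • H,
      floydEDist f S k x ≤ ENNReal.ofReal ε := by
  obtain ⟨c, hc⟩ := ((h.finite_frontier hS.1).image (wordLength S)).bddAbove
  obtain ⟨N, hN⟩ := hf.exists_sum_Ico_le (half_pos hε)
  obtain ⟨B, hB, hBN⟩ := finite_wordLength_mul_le hS (N + c)
  obtain ⟨B', hB', hBN'⟩ := exists_finite_floydEDist_mul_right_le hS hf c (half_pos hε)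
  refine ⟨B ∪ B', hB.union hB', fun k hk h1 x hx => ?_⟩
  rw [mem_union, not_or] at hk
  -- The geodesic from `x` to the identity leaves `k • H` at `y`. Translating back, `k⁻¹ * y` lies
  -- in the finite frontier of `H`, so `y` is within `c` of `k`, while the geodesic segment beyond
  -- `y` costs only a tail of the series.
  obtain ⟨y, hy, ⟨z, hz, hyz, -⟩, hyx⟩ := exists_frontier_floydEDist_le hS.2 hf h1 hx
  have hb : wordLength S (k⁻¹ * y) ≤ c := by
    refine hc ⟨k⁻¹ * y, ⟨mem_smul_set_iff_inv_smul_mem.1 hy, k⁻¹ * z, ?_, ?_⟩, rfl⟩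
    · exact fun h => hz (mem_smul_set_iff_inv_smul_mem.2 h)
    · exact mulCayley_adj_mul_iff_right.2 hyz
  have h2 := hBN' k hk.2 _ hb
  rw [mul_inv_cancel_left] at h2
  have h3 := wordLength_le_mul_add hS.2 k (k⁻¹ * y)
  rw [mul_inv_cancel_left] at h3
  have h4 := hBN k hk.1
  calc floydEDist f S k x ≤ floydEDist f S k y + floydEDist f S y x := floydEDist_triangle _ _ _ _ _
    _ ≤ ENNReal.ofReal (ε / 2) + ENNReal.ofReal (ε / 2) :=
      add_le_add h2 (hyx.trans (hN _ _ (by omega)))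
    _ = ENNReal.ofReal ε := by
      rw [← ENNReal.ofReal_add (half_pos hε).le (half_pos hε).le, add_halves]

/-- A large ball is a finite net: a point outside is joined to it by a geodesic towards the
identity, whose Floyd length is a tail of the series. -/
theorem totallyBounded_floydSpace (hS : IsFiniteGenSet S) (hf : IsFloydFunction f) :
    TotallyBounded (univ : Set (FloydSpace f S)) := by
  rw [EMetric.totallyBounded_iff]
  intro ε hε
  obtain ⟨r, hr, hrε⟩ := ENNReal.lt_iff_exists_nnreal_btwn.1 hε
  have hr0 : (0 : ℝ) < r := by exact_mod_cast hr
  obtain ⟨N, hN⟩ := hf.exists_sum_Ico_le hr0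
  refine ⟨{g : G | wordLength S g ≤ N + 1}, finite_wordLength_le hS _, fun x _ => ?_⟩
  by_cases hx : wordLength S (x : G) ≤ N + 1
  · exact mem_biUnion (show x ∈ {g : G | wordLength S g ≤ N + 1} from hx)
      (Metric.mem_eball_self hε)
  · obtain ⟨y, hy, ⟨z, hz, -, hyz⟩, hyx⟩ := exists_frontier_floydEDist_le hS.2 hf
      (H := {g : G | N < wordLength S g}) (by simp [wordLength_one]) (x := x)
      (show N < wordLength S (x : G) by omega)
    have hz' : wordLength S z ≤ N := not_lt.1 hz
    have hy' : N < wordLength S y := hy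
    refine mem_biUnion (show y ∈ {g : G | wordLength S g ≤ N + 1} by
      change wordLength S y ≤ N + 1; omega) ?_
    refine (floydEDist_comm (G := G) f S x y).trans_lt ?_
    refine lt_of_le_of_lt (hyx.trans (hN _ _ hy'.le)) ?_
    simpa using hrε

theorem discreteTopology_floydSpace (hf : IsFloydFunction f) :
    DiscreteTopology (FloydSpace f S) := by
  refine discreteTopology_iff_isOpen_singleton.2 fun x => EMetric.isOpen_iff.2 ?_
  rintro _ rfl
  rename_i x
  refine ⟨ENNReal.ofReal (f (wordLength S (x : G))), ENNReal.ofReal_pos.2 (hf.pos' _), fun y hy => ?_⟩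
  by_contra hne
  exact ((floydEDist_comm (G := G) f S x y).trans_lt hy).not_ge
    (le_floydEDist_of_ne hf fun h => hne h.symm)

/-- The Floyd metric with real values. -/
noncomputable abbrev floydPseudoMetricSpace (f : ℕ → ℝ) (hS : IsFiniteGenSet S) :
    PseudoMetricSpace (FloydSpace f S) :=
  PseudoEMetricSpace.toPseudoMetricSpace fun x y => floydEDist_ne_top (G := G) hS.2 x y

end FloydDistance

/-! ### Limit sets in the Floyd boundary. -/

section FloydLimitSet

variable {G : Type*} [Group G] {S : Set G} {f : ℕ → ℝ}

/-- The points of the Floyd boundary that lie in the closure of a subset of the group. -/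
def floydLimitSet (f : ℕ → ℝ) (S : Set G) (H : Set G) :
    Set (completionRemainder (FloydSpace f S)) :=
  limitSet (X := FloydSpace f S) H

/-- An element of the group as a point of the space with the Floyd metric. -/
def toFloyd (f : ℕ → ℝ) (S : Set G) (g : G) : FloydSpace f S := g

variable [hS : Fact (IsFiniteGenSet S)] [hf : Fact (IsFloydFunction f)]

noncomputable instance : PseudoMetricSpace (FloydSpace f S) :=
  floydPseudoMetricSpace f hS.out

instance : DiscreteTopology (FloydSpace f S) := discreteTopology_floydSpace hf.out

instance : CompactSpace (Completion (FloydSpace f S)) :=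
  compactSpace_completion (totallyBounded_floydSpace hS.out hf.out)

omit hf in
theorem floydSpace_dist_le {x y : G} {ε : ℝ} (hε : 0 ≤ ε)
    (h : floydEDist f S x y ≤ ENNReal.ofReal ε) : dist (toFloyd f S x) (toFloyd f S y) ≤ ε :=
  ENNReal.toReal_le_of_le_ofReal hε h

theorem IsAlmostInvariant.exists_le_dist {H : Set G} (h : IsAlmostInvariant H) :
    ∃ δ > 0, ∀ x ∈ H, ∀ y ∈ Hᶜ, δ ≤ dist (toFloyd f S x) (toFloyd f S y) := by
  obtain ⟨δ, hδ, hle⟩ := h.exists_le_floydEDist hS.out hf.out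
  exact ⟨δ, hδ, fun x hx y hy => (ENNReal.ofReal_le_iff_le_toReal
    (floydEDist_ne_top hS.out.2 x y)).1 (hle x hx y hy)⟩

theorem IsAlmostInvariant.isClopen_floydLimitSet {H : Set G} (h : IsAlmostInvariant H) :
    IsClopen (floydLimitSet f S H) := by
  obtain ⟨δ, hδ, hle⟩ := h.exists_le_dist (S := S) (f := f)
  exact isClopen_limitSet hδ hle

theorem IsAlmostInvariant.disjoint_floydLimitSet {H H' : Set G} (h : IsAlmostInvariant H)
    (hd : Disjoint H' H) : Disjoint (floydLimitSet f S H') (floydLimitSet f S H) := by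
  obtain ⟨δ, hδ, hle⟩ := h.exists_le_dist (S := S) (f := f)
  exact (disjoint_limitSet (X := FloydSpace f S) hδ fun x hx y hy => hle x hx y fun hyH =>
    disjoint_left.1 hd hy hyH).symm

end FloydLimitSet

/-! ### Halfspace systems and the trees of pieces they induce. -/

/-- A self-similar tree-like decomposition of a group: the group is the first of finitely many
almost invariant sets `H τ`, each of which is the disjoint union of its piece `P τ` and of translates
`k • H σ` with `(k, σ) ∈ Ch τ`, and these translates are rooted in `P τ`. -/
structure HalfspaceSystem (G : Type*) [Group G] (T : Type*) where
  H : T → Set G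
  P : T → Set G
  Ch : T → Set (G × T)
  root : T
  H_root : H root = univ
  one_mem : 1 ∈ P root
  piece_subset : ∀ τ, P τ ⊆ H τ
  child_subset : ∀ τ, ∀ c ∈ Ch τ, c.1 • H c.2 ⊆ H τ
  child_mem : ∀ τ, ∀ c ∈ Ch τ, c.1 ∈ P τ
  exists_child : ∀ τ, ∀ x ∈ P τ, ∃ c ∈ Ch τ, c.1 = x
  cover : ∀ τ, H τ ⊆ P τ ∪ ⋃ c ∈ Ch τ, c.1 • H c.2
  piece_disjoint : ∀ τ, ∀ c ∈ Ch τ, Disjoint (P τ) (c.1 • H c.2)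
  child_disjoint : ∀ τ, ∀ c ∈ Ch τ, ∀ c' ∈ Ch τ,
    c.1 • H c.2 = c'.1 • H c'.2 ∨ Disjoint (c.1 • H c.2) (c'.1 • H c'.2)
  almostInvariant : ∀ τ, IsAlmostInvariant (H τ)
  infinite : ∀ τ, (H τ).Infinite

namespace HalfspaceSystem

variable {G : Type*} [Group G] {T : Type*} (D : HalfspaceSystem G T)

/-- The translates of the halfspaces that occur in the iterated decomposition of the group are among
the whole group and those which do not contain the identity. -/
def Proper (c : G × T) : Prop :=
  c = (1, D.root) ∨ 1 ∉ c.1 • D.H c.2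

variable {D}

theorem Proper.one_notMem_child {c d : G × T} (hc : D.Proper c) (hd : d ∈ D.Ch c.2) :
    1 ∉ (c.1 * d.1) • D.H d.2 := by
  intro h
  simp only [mul_smul] at h
  rcases hc with rfl | hc
  · rw [one_smul] at h
    exact disjoint_left.1 (D.piece_disjoint _ d hd) D.one_mem h
  · exact hc (smul_set_mono (D.child_subset _ d hd) h)

theorem Proper.child {c d : G × T} (hc : D.Proper c) (hd : d ∈ D.Ch c.2) :
    D.Proper (c.1 * d.1, d.2) :=
  Or.inr (hc.one_notMem_child hd)

variable (D) (f : ℕ → ℝ) (S : Set G)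

/-- The limit sets of the proper translates of the halfspaces. -/
def limitSets : Set (Set (completionRemainder (FloydSpace f S))) :=
  (fun c : G × T => floydLimitSet f S (c.1 • D.H c.2)) '' {c | D.Proper c}

variable {S f} [hS : Fact (IsFiniteGenSet S)] [hf : Fact (IsFloydFunction f)]

theorem isClopen_of_mem_limitSets {U : Set (completionRemainder (FloydSpace f S))}
    (hU : U ∈ D.limitSets f S) : IsClopen U := by
  obtain ⟨c, -, rfl⟩ := hU
  exact ((D.almostInvariant c.2).smul c.1).isClopen_floydLimitSet

omit hf in
theorem univ_mem_limitSets : univ ∈ D.limitSets f S := by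
  refine ⟨(1, D.root), Or.inl rfl, ?_⟩
  simp only [D.H_root, one_smul]
  exact limitSet_univ

variable [Finite T]

theorem exists_finite_dist_le {ε : ℝ} (hε : 0 < ε) : ∃ B : Set G, B.Finite ∧ ∀ c : G × T,
    c.1 ∉ B → 1 ∉ c.1 • D.H c.2 → ∀ x ∈ c.1 • D.H c.2, dist (toFloyd f S c.1) (toFloyd f S x) ≤ ε := by
  choose B hB hB' using fun τ => (D.almostInvariant τ).exists_finite_floydEDist_le hS.out hf.out hε
  refine ⟨⋃ τ, B τ, finite_iUnion hB, fun c hc h1 x hx => floydSpace_dist_le hε.le ?_⟩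
  exact hB' c.2 c.1 (fun h => hc (mem_iUnion.2 ⟨_, h⟩)) h1 x hx

/-- Outside a finite set of translating elements and types, a proper translate stays within `ε / 3`
of its root, so its diameter is at most `2 * ε / 3`. -/
theorem finite_diam_limitSets {ε : ℝ} (hε : 0 < ε) :
    {U ∈ D.limitSets f S | ε ≤ Metric.diam U}.Finite := by
  obtain ⟨B, hB, hBd⟩ := D.exists_finite_dist_le (f := f) (S := S) (show 0 < ε / 3 by positivity)
  have hfin : (insert (1, D.root) (B ×ˢ (univ : Set T))).Finite :=
    (hB.prod finite_univ).insert _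
  refine (hfin.image fun c : G × T => floydLimitSet f S (c.1 • D.H c.2)).subset ?_
  rintro _ ⟨⟨c, hc, rfl⟩, hcd⟩
  refine ⟨c, hc.imp id fun h1 => ⟨?_, mem_univ _⟩, rfl⟩
  by_contra hcB
  have hd : Metric.diam (floydLimitSet f S (c.1 • D.H c.2)) ≤ ε / 3 + ε / 3 := by
    refine Metric.diam_le_of_forall_dist_le (by positivity) fun ξ hξ η hη => ?_
    refine dist_le_of_mem_limitSet (fun x hx y hy => ?_) hξ hη
    exact (dist_triangle_left x y (toFloyd f S c.1)).trans
      (add_le_add (hBd c hcB h1 x hx) (hBd c hcB h1 y hy))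
  have : ε ≤ ε / 3 + ε / 3 := hcd.trans hd
  linarith

omit hS hf [Finite T] in
theorem child_smul_subset {c d : G × T} (hd : d ∈ D.Ch c.2) :
    (c.1 * d.1) • D.H d.2 ⊆ c.1 • D.H c.2 := by
  rw [mul_smul]
  exact smul_set_mono (D.child_subset _ d hd)

/-- Infinitely many children could contribute limit points lying in none of them. However, all but
finitely many children stay within `ε / 2` of their roots, which belong to the piece, so such a
limit point is a limit of the piece. -/
theorem floydLimitSet_eq {c : G × T} (hc : D.Proper c) :
    floydLimitSet f S (c.1 • D.H c.2) = floydLimitSet f S (c.1 • D.P c.2) ∪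
      ⋃ d ∈ D.Ch c.2, floydLimitSet f S ((c.1 * d.1) • D.H d.2) := by
  refine Subset.antisymm (fun ξ hξ => ?_) (union_subset (limitSet_mono (X := FloydSpace f S)
    (smul_set_mono (D.piece_subset _))) (iUnion₂_subset fun d hd =>
      limitSet_mono (X := FloydSpace f S) (D.child_smul_subset hd)))
  by_contra hcon
  rw [mem_union, not_or, mem_iUnion₂] at hcon
  obtain ⟨h1, h2⟩ := hcon
  refine h1 ((mem_limitSet_iff (X := FloydSpace f S)).2 fun ε hε => ?_)
  obtain ⟨B, hB, hBd⟩ := D.exists_finite_dist_le (f := f) (S := S) (half_pos hε)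
  let N : Set (FloydSpace f S) := {x | ∃ y ∈ c.1 • D.P c.2, dist (toFloyd f S y) x ≤ ε / 2}
  let I : Set (G × T) := {d | d ∈ D.Ch c.2 ∧ c.1 * d.1 ∈ B}
  have hI : I.Finite := by
    refine ((hB.prod (finite_univ (α := T))).preimage
      (f := fun d : G × T => (c.1 * d.1, d.2)) ?_).subset fun d hd => ⟨hd.2, mem_univ _⟩
    rintro ⟨a, σ⟩ - ⟨b, σ'⟩ - h
    simpa using h
  have hsub : c.1 • D.H c.2 ⊆ (N : Set G) ∪ ⋃ d ∈ I, (c.1 * d.1) • D.H d.2 := by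
    rintro _ ⟨x, hx, rfl⟩
    rcases D.cover _ hx with hxP | hxC
    · exact Or.inl ⟨_, smul_mem_smul_set hxP, (dist_self _).trans_le (half_pos hε).le⟩
    · obtain ⟨d, hd, hxd⟩ := mem_iUnion₂.1 hxC
      have hxd' : c.1 • x ∈ (c.1 * d.1) • D.H d.2 := by
        rw [mul_smul]; exact smul_mem_smul_set hxd
      by_cases hdB : c.1 * d.1 ∈ B
      · exact Or.inr (mem_biUnion (show d ∈ I from ⟨hd, hdB⟩) hxd')
      · refine Or.inl ⟨c.1 * d.1, smul_mem_smul_set (D.child_mem _ d hd), ?_⟩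
        refine hBd (c.1 * d.1, d.2) hdB ?_ _ hxd'
        exact hc.one_notMem_child hd
  have hξ' := limitSet_mono (X := FloydSpace f S) hsub hξ
  rcases (limitSet_union (X := FloydSpace f S) _ _).subset hξ' with hξ' | hξ'
  · obtain ⟨x, ⟨y, hy, hyx⟩, hx⟩ := mem_limitSet_iff.1 hξ' (ε / 2) (half_pos hε)
    refine ⟨toFloyd f S y, hy, ?_⟩
    rw [← Completion.dist_eq, dist_comm] at hyx
    linarith [dist_triangle (ξ : Completion (FloydSpace f S)) x (toFloyd f S y)]
  · obtain ⟨d, hd, hξd⟩ := mem_iUnion₂.1 ((limitSet_biUnion (X := FloydSpace f S) hI _).subset hξ')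
    exact absurd ⟨d, hd.1, hξd⟩ h2

/-- Infinitely many elements of the piece lie near a limit point of it. Each is the root of an
infinite child, and for all but finitely many the child is small, so its limit points are near too.
-/
theorem floydLimitSet_piece_subset_closure {c : G × T} (hc : D.Proper c) :
    floydLimitSet f S (c.1 • D.P c.2) ⊆
      closure (⋃ d ∈ D.Ch c.2, floydLimitSet f S ((c.1 * d.1) • D.H d.2)) := by
  intro ξ hξ
  rw [Metric.mem_closure_iff]
  intro ε hε
  obtain ⟨B, hB, hBd⟩ := D.exists_finite_dist_le (f := f) (S := S) (show 0 < ε / 3 by positivity)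
  let Q : Set (FloydSpace f S) :=
    {x | x ∈ c.1 • D.P c.2 ∧ dist (ξ : Completion (FloydSpace f S)) x < ε / 3}
  have hξQ : ξ ∈ limitSet Q := by
    refine mem_limitSet_iff.2 fun δ hδ => ?_
    obtain ⟨x, hx, hxd⟩ := (mem_limitSet_iff (X := FloydSpace f S)).1 hξ (min δ (ε / 3))
      (lt_min hδ (by positivity))
    exact ⟨x, ⟨hx, hxd.trans_le (min_le_right _ _)⟩, hxd.trans_le (min_le_left _ _)⟩
  have hQ : Q.Infinite := fun hfin => by
    rw [limitSet_eq_empty hfin] at hξQ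
    exact hξQ
  obtain ⟨x, ⟨hxP, hxξ⟩, hxB⟩ := hQ.exists_notMem_finite hB
  obtain ⟨p, hp, rfl⟩ := hxP
  obtain ⟨d, hd, rfl⟩ := D.exists_child _ p hp
  have hinf : ((c.1 * d.1) • D.H d.2).Infinite := (D.infinite d.2).smul_set
  obtain ⟨η, hη⟩ := limitSet_nonempty (X := FloydSpace f S) hinf
  refine ⟨η, mem_biUnion hd hη, ?_⟩
  have h1 : 1 ∉ (c.1 * d.1) • D.H d.2 := hc.one_notMem_child hd
  obtain ⟨y, hy, hyη⟩ := (mem_limitSet_iff (X := FloydSpace f S)).1 hη (ε / 3) (by positivity)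
  have h2 : dist (toFloyd f S (c.1 * d.1)) (toFloyd f S y) ≤ ε / 3 :=
    hBd (c.1 * d.1, d.2) hxB h1 y hy
  have h5 : dist (toFloyd f S y : Completion (FloydSpace f S)) η < ε / 3 := by
    rw [dist_comm]; exact hyη
  rw [← Completion.dist_eq] at h2
  have h3 := dist_triangle4 (ξ : Completion (FloydSpace f S)) (toFloyd f S (c.1 * d.1))
    (toFloyd f S y) η
  rw [Subtype.dist_eq]
  refine h3.trans_lt ?_
  have h4 : dist (ξ : Completion (FloydSpace f S)) (toFloyd f S (c.1 * d.1)) < ε / 3 := hxξ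
  linarith

omit [Finite T] in
theorem disjoint_floydLimitSet_piece {c d : G × T} (hd : d ∈ D.Ch c.2) :
    Disjoint (floydLimitSet f S (c.1 • D.P c.2)) (floydLimitSet f S ((c.1 * d.1) • D.H d.2)) := by
  refine ((D.almostInvariant _).smul _).disjoint_floydLimitSet ?_
  rw [mul_smul, disjoint_smul_set]
  exact D.piece_disjoint _ d hd

omit [Finite T] in
theorem eq_or_disjoint_floydLimitSet {c d d' : G × T} (hd : d ∈ D.Ch c.2) (hd' : d' ∈ D.Ch c.2) :
    floydLimitSet f S ((c.1 * d.1) • D.H d.2) = floydLimitSet f S ((c.1 * d'.1) • D.H d'.2) ∨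
    Disjoint (floydLimitSet f S ((c.1 * d.1) • D.H d.2))
      (floydLimitSet f S ((c.1 * d'.1) • D.H d'.2)) := by
  rcases D.child_disjoint _ d hd d' hd' with h | h
  · left
    rw [mul_smul, mul_smul, h]
  · refine Or.inr (((D.almostInvariant _).smul _).disjoint_floydLimitSet ?_)
    rwa [mul_smul, mul_smul, disjoint_smul_set]

theorem isPieceTree {K : Type*} [TopologicalSpace K]
    (hK : ∀ c : G × T, ∃ h : K → completionRemainder (FloydSpace f S), Continuous h ∧
      Function.Injective h ∧ range h = floydLimitSet f S (c.1 • D.P c.2)) :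
    IsPieceTree K (D.limitSets f S) where
  univ_mem := D.univ_mem_limitSets
  isClopen _ := D.isClopen_of_mem_limitSets
  finite_diam _ hε := D.finite_diam_limitSets hε
  decomp := by
    rintro _ ⟨c, hc, rfl⟩
    obtain ⟨h, hcont, hinj, hr⟩ := hK c
    refine ⟨h, (fun d : G × T => floydLimitSet f S ((c.1 * d.1) • D.H d.2)) '' D.Ch c.2,
      hcont, hinj, ?_, ?_, ?_, ?_, ?_⟩
    · rintro _ ⟨d, hd, rfl⟩
      exact ⟨(c.1 * d.1, d.2), hc.child hd, rfl⟩
    · rintro _ ⟨d, hd, rfl⟩ _ ⟨d', hd', rfl⟩ hne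
      exact (D.eq_or_disjoint_floydLimitSet hd hd').resolve_left hne
    · rintro _ ⟨d, hd, rfl⟩
      rw [hr]
      exact D.disjoint_floydLimitSet_piece hd
    · rw [hr, sUnion_image]
      exact D.floydLimitSet_eq hc
    · rw [hr, sUnion_image]
      exact D.floydLimitSet_piece_subset_closure hc

/-- Finite pieces have no limit points, so each boundary point in a limit set passes to a child, a
proper subset because there are two disjoint children. Such a chain must shrink by nullity, which
yields a clopen neighbourhood basis and excludes isolated points. -/
theorem nonempty_homeomorph_cantorSpace (hP : ∀ τ, (D.P τ).Finite)
    (hD : ∀ τ, ∃ c ∈ D.Ch τ, ∃ c' ∈ D.Ch τ, Disjoint (c.1 • D.H c.2) (c'.1 • D.H c'.2)) :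
    Nonempty (completionRemainder (FloydSpace f S) ≃ₜ (ℕ → Bool)) := by
  have hstep : ∀ ξ, ∀ U ∈ D.limitSets f S, ξ ∈ U → ∃ V ∈ D.limitSets f S, ξ ∈ V ∧ V ⊂ U := by
    rintro ξ _ ⟨c, hc, rfl⟩ hξ
    have heq := D.floydLimitSet_eq (f := f) (S := S) hc
    have hξ' := heq.subset hξ
    rw [show floydLimitSet f S (c.1 • D.P c.2) = ∅ from
      limitSet_eq_empty (X := FloydSpace f S) (hP c.2).smul_set, empty_union] at hξ'
    obtain ⟨d, hd, hξd⟩ := mem_iUnion₂.1 hξ'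
    refine ⟨_, ⟨(c.1 * d.1, d.2), hc.child hd, rfl⟩, hξd, ?_⟩
    refine (limitSet_mono (X := FloydSpace f S) (D.child_smul_subset hd)).ssubset_of_not_superset ?_
    intro hsub
    -- If the child were not strictly smaller, it would meet every child and so equal every child,
    -- contradicting the two disjoint ones.
    have hall : ∀ d' ∈ D.Ch c.2, ¬ Disjoint (d.1 • D.H d.2) (d'.1 • D.H d'.2) := by
      intro d' hd' hdis
      obtain ⟨η, hη⟩ := limitSet_nonempty (X := FloydSpace f S)
        ((D.infinite d'.2).smul_set (a := c.1 * d'.1))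
      have hη' := hsub (limitSet_mono (X := FloydSpace f S) (D.child_smul_subset hd') hη)
      refine disjoint_left.1 (((D.almostInvariant d'.2).smul _).disjoint_floydLimitSet ?_) hη' hη
      rw [mul_smul, mul_smul, disjoint_smul_set]
      exact hdis
    obtain ⟨e, he, e', he', hee⟩ := hD c.2
    have h1 := (D.child_disjoint _ d hd e he).resolve_right (hall e he)
    have h2 := (D.child_disjoint _ d hd e' he').resolve_right (hall e' he')
    rw [← h1, ← h2, disjoint_self] at hee
    exact (D.infinite d.2).smul_set.nonempty.ne_empty hee
  have hsmall : ∀ ξ, ∀ ε > 0, ∃ U ∈ D.limitSets f S, ξ ∈ U ∧ Metric.diam U < ε := by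
    intro ξ ε hε
    by_contra! hcon
    choose! V hV hξV hVU using hstep ξ
    let b : ℕ → Set (completionRemainder (FloydSpace f S)) := fun n => Nat.rec univ (fun _ U => V U) n
    have hb : ∀ n, b n ∈ D.limitSets f S ∧ ξ ∈ b n := by
      intro n
      induction n with
      | zero => exact ⟨D.univ_mem_limitSets, mem_univ ξ⟩
      | succ n ih => exact ⟨hV _ ih.1 ih.2, hξV _ ih.1 ih.2⟩
    have hanti : StrictAnti b := strictAnti_nat_of_succ_lt fun n => hVU _ (hb n).1 (hb n).2
    refine infinite_range_of_injective hanti.injective ((D.finite_diam_limitSets hε).subset ?_)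
    rintro _ ⟨n, rfl⟩
    exact ⟨(hb n).1, hcon _ (hb n).1 (hb n).2⟩
  have hinf : (univ : Set (FloydSpace f S)).Infinite := D.H_root ▸ D.infinite D.root
  obtain ⟨ξ₀, -⟩ := limitSet_nonempty hinf
  have : Nonempty (completionRemainder (FloydSpace f S)) := ⟨ξ₀⟩
  have : TotallySeparatedSpace (completionRemainder (FloydSpace f S)) := by
    refine totallySeparatedSpace_iff_exists_isClopen.2 fun ξ η hne => ?_
    obtain ⟨U, hU, hξU, hdiam⟩ := hsmall ξ _ (dist_pos.2 hne)
    refine ⟨U, D.isClopen_of_mem_limitSets hU, hξU, fun hηU => hdiam.not_ge ?_⟩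
    exact Metric.dist_le_diam_of_mem (Bornology.IsBounded.all _) hξU hηU
  have : PerfectSpace (completionRemainder (FloydSpace f S)) := by
    refine ⟨fun ξ _ => accPt_iff_nhds.2 fun W hW => ?_⟩
    obtain ⟨ε, hε, hεW⟩ := Metric.mem_nhds_iff.1 hW
    obtain ⟨U, hU, hξU, hdiam⟩ := hsmall ξ ε hε
    obtain ⟨V, -, hξV, hVU⟩ := hstep ξ U hU hξU
    obtain ⟨η, hηU, hηV⟩ := exists_of_ssubset hVU
    refine ⟨η, ⟨hεW ?_, mem_univ _⟩, fun h => hηV (h ▸ hξV)⟩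
    exact (Metric.dist_le_diam_of_mem (Bornology.IsBounded.all _) hηU hξU).trans_lt hdiam
  exact _root_.nonempty_homeomorph_cantorSpace

end HalfspaceSystem

/-! ### Lipschitz maps between Floyd spaces. -/

section FloydMaps

open SimpleGraph

variable {G : Type*} [Group G] {S : Set G} {f : ℕ → ℝ}

theorem mulCayley_dist_map_le (hS : Subgroup.closure S = ⊤) {G' : Type*} [Group G'] {S' : Set G'}
    (hS' : Subgroup.closure S' = ⊤) {φ : G → G'} {m : ℕ}
    (h : ∀ x y, (mulCayley S).Adj x y → (mulCayley S').dist (φ x) (φ y) ≤ m) (x y : G) :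
    (mulCayley S').dist (φ x) (φ y) ≤ m * (mulCayley S).dist x y := by
  obtain ⟨p, hp⟩ := (mulCayley_connected hS).exists_walk_length_eq_dist x y
  rw [← hp]
  clear hp
  induction p with
  | nil => simp
  | cons hadj q ih =>
    rw [Walk.length_cons, mul_add, mul_one, add_comm]
    exact (mulCayley_connected hS').dist_triangle.trans (add_le_add (h _ _ hadj) ih)

theorem floydEDist_le_mul_of_adj {x y : G} (h : (mulCayley S).Adj x y) {C : ℝ≥0} {m a : ℕ}
    (hC : ∀ a b, a ≤ b + m → ENNReal.ofReal (f b) ≤ C * ENNReal.ofReal (f a))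
    (hx : a ≤ wordLength S x + m) (hy : a ≤ wordLength S y + m) :
    floydEDist f S x y ≤ C * ENNReal.ofReal (f a) := by
  refine (floydEDist_le_of_adj h).trans (hC a _ ?_)
  change a ≤ min (wordLength S x) (wordLength S y) + m
  omega

/-- Left translation moves the base point, so it is not an isometry, but it changes word lengths by
at most `wordLength S k`. -/
theorem exists_floydEDist_mul_left_le (hS : Subgroup.closure S = ⊤) (hf : IsFloydFunction f)
    (k : G) : ∃ C : ℝ≥0, ∀ x y, floydEDist f S (k * x) (k * y) ≤ C * floydEDist f S x y := by
  obtain ⟨C, hC⟩ := hf.exists_le_mul (wordLength S k)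
  refine ⟨C, floydEDist_map_le hS fun x y h => ?_⟩
  have hk : ∀ z, wordLength S z ≤ wordLength S (k * z) + wordLength S k := by
    intro z
    have := wordLength_mul_le hS k⁻¹ (k * z)
    rw [inv_mul_cancel_left, wordLength_inv] at this
    omega
  exact floydEDist_le_mul_of_adj (mulCayley_adj_mul_iff_right.2 h) hC
    ((min_le_left _ _).trans (hk x)) ((min_le_right _ _).trans (hk y))

theorem isUniformInducing_of_floydEDist_le {G' : Type*} [Group G'] {S' : Set G'} {φ : G → G'}
    {C C' : ℝ≥0} (h : ∀ x y, floydEDist f S' (φ x) (φ y) ≤ C * floydEDist f S x y)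
    (h' : ∀ x y, floydEDist f S x y ≤ C' * floydEDist f S' (φ x) (φ y)) :
    IsUniformInducing (fun x : FloydSpace f S => (toFloyd f S' (φ x))) := by
  have h1 : LipschitzWith C fun x : FloydSpace f S => (toFloyd f S' (φ x)) := h
  have h2 : AntilipschitzWith C' fun x : FloydSpace f S => (toFloyd f S' (φ x)) := h'
  exact h2.isUniformInducing h1.uniformContinuous

/-- A subgroup onto which the Cayley graph retracts by a map that is locally constant off the
subgroup is uniformly embedded with respect to the Floyd metrics. -/
theorem isUniformInducing_mul_of_retraction (hS : IsFiniteGenSet S) (hf : IsFloydFunction f)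
    {A : Type*} [Group A] {S₀ : Set A} (hS₀ : IsFiniteGenSet S₀) (ι : A →* G)
    (hι : ∀ s ∈ S₀, ι s ∈ S) (ρ : G → A) (hρι : ∀ a, ρ (ι a) = a)
    (hρ : ∀ x y, (mulCayley S).Adj x y → x ∈ range ι →
      ρ x = ρ y ∨ (mulCayley S₀).Adj (ρ x) (ρ y))
    (hρ' : ∀ x y, (mulCayley S).Adj x y → x ∉ range ι → y ∉ range ι → ρ x = ρ y) (k : G) :
    IsUniformInducing (fun a : FloydSpace f S₀ => toFloyd f S (k * ι a)) := by
  have hadj : ∀ a b, (mulCayley S₀).Adj a b → (mulCayley S).Adj (ι a) (ι b) := by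
    intro a b hab
    rw [mulCayley_adj] at hab ⊢
    refine ⟨fun h => hab.1 (by rw [← hρι a, h, hρι]), ?_⟩
    rw [← map_inv, ← map_inv, ← map_mul, ← map_mul]
    exact hab.2.imp (hι _) (hι _)
  have hρx : ∀ x y, (mulCayley S).Adj x y → x ∈ range ι ∨ y ∈ range ι →
      ρ x = ρ y ∨ (mulCayley S₀).Adj (ρ x) (ρ y) := fun x y h hxy =>
    hxy.elim (hρ x y h) fun hy => (hρ y x h.symm hy).imp Eq.symm fun h => h.symm
  have hρdist : ∀ x y, (mulCayley S).Adj x y → (mulCayley S₀).dist (ρ x) (ρ y) ≤ 1 := by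
    intro x y h
    have : ρ x = ρ y ∨ (mulCayley S₀).Adj (ρ x) (ρ y) := by
      by_cases hxy : x ∈ range ι ∨ y ∈ range ι
      · exact hρx x y h hxy
      · rw [not_or] at hxy
        exact Or.inl (hρ' x y h hxy.1 hxy.2)
    rcases this with h | h
    · rw [h, SimpleGraph.dist_self]; exact zero_le_one
    · exact (dist_eq_one_iff_adj.2 h).le
  -- Both the inclusion and the retraction are `1`-Lipschitz for the graph metrics.
  have hlen : ∀ a, wordLength S (ι a) = wordLength S₀ a := by
    intro a
    have h1 := mulCayley_dist_map_le hS₀.2 hS.2 (m := 1)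
      (fun x y h => (dist_eq_one_iff_adj.2 (hadj x y h)).le) 1 a
    have h2 := mulCayley_dist_map_le hS.2 hS₀.2 hρdist 1 (ι a)
    rw [map_one, one_mul] at h1
    rw [← map_one ι, hρι, hρι, map_one, one_mul] at h2
    exact le_antisymm h1 h2
  have h1 : ∀ a b, floydEDist f S (ι a) (ι b) ≤ (1 : ℝ≥0) * floydEDist f S₀ a b := by
    refine floydEDist_map_le hS₀.2 fun a b h => (floydEDist_le_of_adj (hadj a b h)).trans ?_
    rw [ENNReal.coe_one, one_mul]
    change ENNReal.ofReal (f (min (wordLength S _) (wordLength S _))) ≤ _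
    rw [hlen, hlen]
    exact le_rfl
  -- An edge touching the subgroup shares the word length of one endpoint with its image; the other
  -- endpoint of the image may be shorter by `1`, hence the shift by `1`.
  obtain ⟨C, hC⟩ := hf.exists_le_mul 1
  have h2 : ∀ x y, floydEDist f S₀ (ρ x) (ρ y) ≤ C * floydEDist f S x y := by
    refine floydEDist_map_le hS.2 fun x y h => ?_
    by_cases hxy : x ∈ range ι ∨ y ∈ range ι
    · rcases hρx x y h hxy with h3 | h3
      · rw [h3, floydEDist_self]; exact zero_le
      · have h4 := wordLength_le_of_adj hS₀.2 h3
        have h5 := wordLength_le_of_adj hS₀.2 h3.symm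
        have h6 : min (wordLength S x) (wordLength S y) ≤
            max (wordLength S₀ (ρ x)) (wordLength S₀ (ρ y)) := by
          rcases hxy with ⟨a, rfl⟩ | ⟨a, rfl⟩
          · refine (min_le_left _ _).trans (le_trans ?_ (le_max_left _ _))
            rw [hlen, hρι]
          · refine (min_le_right _ _).trans (le_trans ?_ (le_max_right _ _))
            rw [hlen, hρι]
        refine floydEDist_le_mul_of_adj h3 hC (h6.trans ?_) (h6.trans ?_) <;> omega
    · rw [not_or] at hxy
      rw [hρ' x y h hxy.1 hxy.2, floydEDist_self]; exact zero_le
  obtain ⟨D, hD⟩ := exists_floydEDist_mul_left_le hS.2 hf k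
  obtain ⟨D', hD'⟩ := exists_floydEDist_mul_left_le hS.2 hf k⁻¹
  refine isUniformInducing_of_floydEDist_le (C := D * 1) (C' := C * D') (φ := fun a => k * ι a)
    (fun a b => ?_) fun a b => ?_
  · refine (hD _ _).trans ?_
    rw [ENNReal.coe_mul, mul_assoc]
    gcongr
    exact h1 a b
  · have h3 := h2 (ι a) (ι b)
    rw [hρι, hρι] at h3
    refine h3.trans ?_
    rw [ENNReal.coe_mul, mul_assoc]
    gcongr
    simpa using hD' (k * ι a) (k * ι b)

/-- `P` may omit finitely many elements, since in a free product the piece of a halfspace is a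
factor without its identity. -/
theorem exists_embedding_range_eq_floydLimitSet [hS : Fact (IsFiniteGenSet S)]
    [hf : Fact (IsFloydFunction f)] {A : Type*} [Group A] {S₀ : Set A}
    [hS₀ : Fact (IsFiniteGenSet S₀)] {φ : A → G}
    (hφ : IsUniformInducing (fun a : FloydSpace f S₀ => toFloyd f S (φ a))) {P : Set G}
    (hP : P ⊆ range φ) (hP' : (range φ \ P).Finite) :
    ∃ h : completionRemainder (FloydSpace f S₀) → completionRemainder (FloydSpace f S),
      Continuous h ∧ Function.Injective h ∧ range h = floydLimitSet f S P := by
  obtain ⟨h, hc, hi, hr⟩ := exists_embedding_range_eq_limitSet hφ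
  refine ⟨h, hc, hi, hr.trans ?_⟩
  have h1 : range φ = P ∪ (range φ \ P) := (union_sdiff_cancel hP).symm
  exact (congrArg (floydLimitSet f S) h1).trans
    (limitSet_union_of_finite (X := FloydSpace f S) P hP')

theorem IsFloydFunction.exists_le_mul_of_doubling (hf : IsFloydFunction f)
    (hD : ∃ D : ℝ, ∀ n : ℕ, f n ≤ D * f (2 * n)) (m : ℕ) :
    ∃ C : ℝ≥0, ∀ a b, a ≤ m * b → ENNReal.ofReal (f b) ≤ C * ENNReal.ofReal (f a) := by
  obtain ⟨D, hD⟩ := hD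
  have hD0 : 0 ≤ D := by
    have h1 := hD 0
    have h2 := hf.pos' 0
    have h3 := hf.pos' (2 * 0)
    by_contra hneg
    nlinarith
  have key : ∀ j b, f b ≤ D ^ j * f (2 ^ j * b) := by
    intro j
    induction j with
    | zero => simp
    | succ j ih =>
      intro b
      refine (ih b).trans ?_
      rw [pow_succ, mul_assoc, pow_succ', mul_assoc]
      exact mul_le_mul_of_nonneg_left (hD _) (pow_nonneg hD0 j)
  -- Doubling `m` times suffices because `m ≤ 2 ^ m`.
  refine ⟨Real.toNNReal (D ^ m), fun a b hab => ?_⟩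
  change _ ≤ ENNReal.ofReal (D ^ m) * _
  rw [← ENNReal.ofReal_mul (pow_nonneg hD0 m)]
  refine ENNReal.ofReal_le_ofReal ((key m b).trans
    (mul_le_mul_of_nonneg_left (hf.antitone' (hab.trans ?_)) (pow_nonneg hD0 m)))
  exact Nat.mul_le_mul_right b Nat.lt_two_pow_self.le

/-- An `S`-edge becomes an `S'`-path of bounded length, which costs a bounded shift in `f`. The two
word lengths are comparable only up to a factor, and this is where doubling is needed. -/
theorem exists_floydEDist_change_le (hS : IsFiniteGenSet S) {S' : Set G} (hS' : IsFiniteGenSet S')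
    (hf : IsFloydFunction f) (hD : ∃ D : ℝ, ∀ n : ℕ, f n ≤ D * f (2 * n)) :
    ∃ C : ℝ≥0, ∀ x y, floydEDist f S' x y ≤ C * floydEDist f S x y := by
  have hbound : ∀ {S S' : Set G}, IsFiniteGenSet S → IsFiniteGenSet S' →
      ∃ m, ∀ s, s ∈ S ∨ s⁻¹ ∈ S → wordLength S' s ≤ m := by
    intro S S' hS hS'
    obtain ⟨m, hm⟩ := (hS.1.image (wordLength S')).bddAbove
    refine ⟨m, fun s hs => hs.elim (fun h => hm ⟨s, h, rfl⟩) fun h => ?_⟩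
    rw [← wordLength_inv]
    exact hm ⟨s⁻¹, h, rfl⟩
  obtain ⟨m, hm⟩ := hbound hS hS'
  obtain ⟨m', hm'⟩ := hbound hS' hS
  have hlen : ∀ x, wordLength S x ≤ m' * wordLength S' x := by
    intro x
    refine mulCayley_dist_map_le hS'.2 hS.2 (φ := id) (fun x y h => ?_) 1 x
    obtain ⟨s, hs, rfl⟩ := exists_mul_of_mulCayley_adj h
    exact (mulCayley_dist_mul_right x s).trans_le (hm' s hs)
  obtain ⟨C₁, hC₁⟩ := hf.exists_le_mul m
  obtain ⟨C₂, hC₂⟩ := hf.exists_le_mul_of_doubling hD m'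
  refine ⟨m * (C₁ * C₂), floydEDist_map_le (φ := id) hS.2 fun x y h => ?_⟩
  obtain ⟨s, hs, rfl⟩ := exists_mul_of_mulCayley_adj h
  refine (floydEDist_mul_right_le hS'.2 hf x s).trans ?_
  have h1 := hm s hs
  rw [ENNReal.coe_mul, ENNReal.coe_mul, mul_assoc, mul_assoc]
  refine mul_le_mul' (by exact_mod_cast h1) ?_
  refine (hC₁ (wordLength S' x) _ (by omega)).trans ?_
  gcongr
  exact hC₂ _ _ ((min_le_left _ _).trans (hlen x))

/-- If the Floyd function is doubling, then the Floyd boundary does not depend on the generating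
set. -/
theorem nonempty_homeomorph_floydBoundary_change (hS : IsFiniteGenSet S) {S' : Set G}
    (hS' : IsFiniteGenSet S') (hf : IsFloydFunction f)
    (hD : ∃ D : ℝ, ∀ n : ℕ, f n ≤ D * f (2 * n)) :
    Nonempty (floydBoundary f S ≃ₜ floydBoundary f S') := by
  have : Fact (IsFiniteGenSet S) := ⟨hS⟩
  have : Fact (IsFiniteGenSet S') := ⟨hS'⟩
  have : Fact (IsFloydFunction f) := ⟨hf⟩
  obtain ⟨C, hC⟩ := exists_floydEDist_change_le hS hS' hf hD
  obtain ⟨C', hC'⟩ := exists_floydEDist_change_le hS' hS hf hD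
  exact nonempty_homeomorph_completionRemainder
    (isUniformInducing_of_floydEDist_le (φ := id) hC hC') Function.surjective_id

end FloydMaps

/-! ### Halfspaces and retraction in an HNN extension. -/

namespace HNNExtension

open NormalWord

variable {A : Type*} [Group A] {F F' : Subgroup A} (φ : F ≃* F')

/-- The elements of the HNN extension whose normal form begins with `t ^ u`, up to an element of the
corresponding associated subgroup. -/
def halfspace (u : ℤˣ) : Set (HNNExtension A F F' φ) :=
  {g | Cancels (-u) (g • (empty : NormalWord (TransversalPair.nonempty A F F').some))}

variable {φ}

theorem of_notMem_halfspace (a : A) (u : ℤˣ) : (of a : HNNExtension A F F' φ) ∉ halfspace φ u := by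
  simp [halfspace, Cancels, of_smul_eq_smul]

theorem one_notMem_halfspace (u : ℤˣ) : (1 : HNNExtension A F F' φ) ∉ halfspace φ u := by
  simpa using of_notMem_halfspace (φ := φ) 1 u

theorem of_mul_mem_halfspace {a : A} {u v : ℤˣ} {g : HNNExtension A F F' φ}
    (hg : g ∈ halfspace φ u) : of a * g ∈ halfspace φ v ↔ v = u ∧ a ∈ toSubgroup F F' (-u) := by
  obtain ⟨h1, h2⟩ := hg
  simp only [halfspace, Cancels, mem_ofPred_eq, mul_smul, of_smul_eq_smul, group_smul_head,
    group_smul_toList, h2, Option.some.injEq, neg_neg]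
  constructor
  · rintro ⟨h3, rfl⟩
    exact ⟨rfl, (Subgroup.mul_mem_cancel_right _ h1).1 h3⟩
  · rintro ⟨rfl, h3⟩
    exact ⟨mul_mem h3 h1, rfl⟩

theorem t_zpow_mul_mem_halfspace {u : ℤˣ} {g : HNNExtension A F F' φ} :
    t ^ (u : ℤ) * g ∈ halfspace φ u ↔ g ∉ halfspace φ (-u) := by
  simp only [halfspace, mem_ofPred_eq, mul_smul, t_pow_smul_eq_unitsSMul, unitsSMul_cancels_iff,
    neg_neg]

theorem t_zpow_mem_halfspace (u : ℤˣ) : (t ^ (u : ℤ) : HNNExtension A F F' φ) ∈ halfspace φ u := by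
  have := t_zpow_mul_mem_halfspace (φ := φ) (u := u) (g := 1)
  rw [mul_one] at this
  exact this.2 (one_notMem_halfspace _)

theorem of_or_mem_halfspace (g : HNNExtension A F F' φ) :
    (∃ a, of a = g) ∨ ∃ (a : A) (u : ℤˣ), (of a)⁻¹ * g ∈ halfspace φ u := by
  let d := (TransversalPair.nonempty A F F').some
  let w : NormalWord d := g • empty
  have hw : w.prod φ = g := by simp [w]
  rcases hl : w.toList with _ | ⟨⟨u, b⟩, l⟩
  · left
    refine ⟨w.head, ?_⟩
    rw [← hw, ReducedWord.prod, hl]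
    simp
  · right
    refine ⟨w.head, u, ?_⟩
    rw [← map_inv]
    change Cancels (-u) ((of w.head⁻¹ * g) • (empty : NormalWord d))
    rw [mul_smul, of_smul_eq_smul]
    refine ⟨?_, ?_⟩
    · rw [group_smul_head, inv_mul_cancel]
      exact one_mem _
    · rw [group_smul_toList, hl]
      simp

theorem normal_induction {p : HNNExtension A F F' φ → Prop} (of_mem : ∀ a, p (of a))
    (cons : ∀ (a : A) (u : ℤˣ) (y), y ∉ halfspace φ (-u) → p y → p (of a * (t ^ (u : ℤ) * y)))
    (g : HNNExtension A F F' φ) : p g := by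
  let d := (TransversalPair.nonempty A F F').some
  have key : ∀ w : NormalWord d, p (w.prod φ) := by
    intro w
    induction w using consRecOn with
    | ofGroup a => simpa [ReducedWord.prod] using of_mem a
    | cons a u w h1 h2 ih =>
      rw [prod_cons]
      refine cons a u _ (fun h => not_cancels_of_cons_hyp u w h2 ?_) ih
      have h' : Cancels (- -u) ((w.prod φ) • (empty : NormalWord d)) := h
      rwa [neg_neg, prod_smul_empty] at h'
  simpa using key (g • (empty : NormalWord d))

theorem t_zpow_conj_mem {u : ℤˣ} {a : A} (ha : a ∈ toSubgroup F F' u) :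
    ∃ b ∈ toSubgroup F F' (-u),
      (t ^ (u : ℤ) * of a * t ^ (-(u : ℤ)) : HNNExtension A F F' φ) = of b := by
  rcases Int.units_eq_one_or u with rfl | rfl
  · exact ⟨φ ⟨a, ha⟩, (φ ⟨a, ha⟩).2, by simp [equiv_eq_conj]⟩
  · exact ⟨φ.symm ⟨a, ha⟩, (φ.symm ⟨a, ha⟩).2, by simp [equiv_symm_eq_conj]⟩

/-- The elements of the base group and the powers `t ^ (±1)` of the stable letter. -/
def IsLetter (s : HNNExtension A F F' φ) : Prop :=
  (∃ a, s = of a) ∨ ∃ u : ℤˣ, s = t ^ (u : ℤ)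

theorem of_mul_letter_mem_halfspace {a : A} {s : HNNExtension A F F' φ} (hs : IsLetter s) {v : ℤˣ}
    (h : of a * s ∈ halfspace φ v) : a ∈ toSubgroup F F' (-v) ∧ s = t ^ (v : ℤ) := by
  rcases hs with ⟨b, rfl⟩ | ⟨u, rfl⟩
  · rw [← map_mul] at h
    exact absurd h (of_notMem_halfspace _ _)
  · obtain ⟨rfl, ha⟩ := (of_mul_mem_halfspace (t_zpow_mem_halfspace u)).1 h
    exact ⟨ha, rfl⟩

/-- Right multiplication by a letter alters the end of the normal form, so it can affect the
beginning only for very short words. Consequently the outer endpoint of an edge crossing the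
boundary of a halfspace lies in an associated subgroup, and finiteness of the latter gives almost
invariance. -/
theorem exists_of_of_crossing {s : HNNExtension A F F' φ} (hs : IsLetter s)
    (y : HNNExtension A F F' φ) : ∀ v : ℤˣ,
    (y ∈ halfspace φ v → y * s ∉ halfspace φ v → ∃ b ∈ toSubgroup F F' (-v), y * s = of b) ∧
    (y ∉ halfspace φ v → y * s ∈ halfspace φ v → ∃ b ∈ toSubgroup F F' (-v), y = of b) := by
  induction y using normal_induction with
  | of_mem a =>
    refine fun v => ⟨fun h => absurd h (of_notMem_halfspace a v), fun _ h => ?_⟩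
    exact ⟨a, (of_mul_letter_mem_halfspace hs h).1, rfl⟩
  | cons a u y hy ih =>
    intro v
    have htu : t ^ (u : ℤ) * y ∈ halfspace φ u := t_zpow_mul_mem_halfspace.2 hy
    -- crossing back over the halfspace of `t ^ (-u)` leads to the base group
    have hback : y * s ∈ halfspace φ (-u) →
        ∃ b ∈ toSubgroup F F' (-u), of a * (t ^ (u : ℤ) * y) * s = of (a * b) := by
      intro h
      obtain ⟨b, hb, rfl⟩ := (ih (-u)).2 hy h
      obtain ⟨-, rfl⟩ := of_mul_letter_mem_halfspace hs h
      rw [neg_neg] at hb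
      obtain ⟨c, hc, hc'⟩ := t_zpow_conj_mem (φ := φ) hb
      refine ⟨c, hc, ?_⟩
      rw [map_mul, ← hc']
      simp [mul_assoc]
    constructor
    · intro h1 h2
      obtain ⟨rfl, ha⟩ := (of_mul_mem_halfspace htu).1 h1
      have hys : y * s ∈ halfspace φ (-v) := by
        by_contra hcon
        refine h2 ?_
        rw [mul_assoc, mul_assoc, of_mul_mem_halfspace (t_zpow_mul_mem_halfspace.2 hcon)]
        exact ⟨rfl, ha⟩
      obtain ⟨b, hb, hb'⟩ := hback hys
      exact ⟨a * b, mul_mem ha hb, hb'⟩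
    · intro h1 h2
      by_cases hys : y * s ∈ halfspace φ (-u)
      · obtain ⟨b, -, hb'⟩ := hback hys
        rw [hb'] at h2
        exact absurd h2 (of_notMem_halfspace _ _)
      · rw [mul_assoc, mul_assoc,
          of_mul_mem_halfspace (t_zpow_mul_mem_halfspace.2 hys)] at h2
        exact absurd ((of_mul_mem_halfspace htu).2 h2) h1

theorem closure_hnnGenSet {S : Set A} (hS : Subgroup.closure S = ⊤) :
    Subgroup.closure (hnnGenSet φ S) = ⊤ := by
  rw [eq_top_iff]
  have hof : ∀ a, (of a : HNNExtension A F F' φ) ∈ Subgroup.closure (hnnGenSet φ S) := by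
    intro a
    have ha : (of a : HNNExtension A F F' φ) ∈ (Subgroup.closure S).map of :=
      ⟨a, hS ▸ Subgroup.mem_top a, rfl⟩
    rw [MonoidHom.map_closure] at ha
    exact Subgroup.closure_mono subset_union_left ha
  intro g _
  induction g using HNNExtension.induction_on with
  | of a => exact hof a
  | t => exact Subgroup.subset_closure (Or.inr rfl)
  | mul x y hx hy => exact mul_mem (hx trivial) (hy trivial)
  | inv x hx => exact inv_mem (hx trivial)

theorem isFiniteGenSet_hnnGenSet {S : Set A} (hS : IsFiniteGenSet S) :
    IsFiniteGenSet (hnnGenSet φ S) :=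
  ⟨(hS.1.image _).union (finite_singleton _), closure_hnnGenSet hS.2⟩

theorem isLetter_of_mem {S : Set A} {s : HNNExtension A F F' φ}
    (hs : s ∈ hnnGenSet φ S ∨ s⁻¹ ∈ hnnGenSet φ S) :
    (∃ a, (a ∈ S ∨ a⁻¹ ∈ S) ∧ s = of a) ∨ ∃ u : ℤˣ, s = t ^ (u : ℤ) := by
  rcases hs with (⟨a, ha, rfl⟩ | hs) | (⟨a, ha, h⟩ | hs)
  · exact Or.inl ⟨a, Or.inl ha, rfl⟩
  · exact Or.inr ⟨1, by simpa using hs⟩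
  · exact Or.inl ⟨a⁻¹, Or.inr (by simpa using ha), by rw [map_inv, h, inv_inv]⟩
  · exact Or.inr ⟨-1, by simpa [inv_eq_iff_eq_inv] using hs⟩

theorem isLetter_of_mem' {S : Set A} {s : HNNExtension A F F' φ}
    (hs : s ∈ hnnGenSet φ S ∨ s⁻¹ ∈ hnnGenSet φ S) : IsLetter s :=
  (isLetter_of_mem hs).imp (fun ⟨a, _, h⟩ => ⟨a, h⟩) id

/-- The branches at the base vertex of the Bass–Serre tree correspond to a sign together with a
coset of the associated subgroup. -/
theorem smul_halfspace_eq_or_disjoint (a b : A) (u v : ℤˣ) :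
    ((of a : HNNExtension A F F' φ) • halfspace φ u = (of b : HNNExtension A F F' φ) • halfspace φ v ∧
      u = v ∧ b⁻¹ * a ∈ toSubgroup F F' (-u)) ∨
    Disjoint ((of a : HNNExtension A F F' φ) • halfspace φ u)
      ((of b : HNNExtension A F F' φ) • halfspace φ v) := by
  rw [or_iff_not_imp_right, not_disjoint_iff]
  rintro ⟨_, ⟨x, hx, rfl⟩, hy⟩
  have hy' : of (b⁻¹ * a) * x ∈ halfspace φ v := by
    rw [mem_smul_set_iff_inv_smul_mem] at hy
    simpa [mul_assoc] using hy
  obtain ⟨rfl, hab⟩ := (of_mul_mem_halfspace hx).1 hy'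
  refine ⟨?_, rfl, hab⟩
  have h1 : (of (b⁻¹ * a) : HNNExtension A F F' φ) • halfspace φ v = halfspace φ v := by
    refine Subset.antisymm ?_ fun y hy => ?_
    · rintro _ ⟨y, hy, rfl⟩
      exact (of_mul_mem_halfspace hy).2 ⟨rfl, hab⟩
    · rw [mem_smul_set_iff_inv_smul_mem, ← map_inv]
      exact (of_mul_mem_halfspace hy).2 ⟨rfl, inv_mem hab⟩
  calc (of a : HNNExtension A F F' φ) • halfspace φ v
      = (of b : HNNExtension A F F' φ) • (of (b⁻¹ * a) : HNNExtension A F F' φ) • halfspace φ v := by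
        rw [← mul_smul, ← map_mul, mul_inv_cancel_left]
    _ = _ := by rw [h1]

theorem units_ne_neg (u : ℤˣ) : u ≠ -u := by
  rcases Int.units_eq_one_or u with rfl | rfl <;> decide

theorem disjoint_halfspace_neg (u : ℤˣ) : Disjoint (halfspace φ u) (halfspace φ (-u)) := by
  refine disjoint_left.2 fun x hx hx' => ?_
  have h1 := (of_mul_mem_halfspace (a := 1) hx).1 (by rw [map_one, one_mul]; exact hx')
  exact units_ne_neg u h1.1.symm

/-- Multiplication by `t ^ u` maps the halfspace injectively into itself and misses `t ^ u`, whose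
preimage is `1`. -/
theorem infinite_halfspace (u : ℤˣ) : (halfspace φ u).Infinite := by
  intro hfin
  have hsub : (fun x => t ^ (u : ℤ) * x) '' halfspace φ u ⊆ halfspace φ u := by
    rintro _ ⟨x, hx, rfl⟩
    exact t_zpow_mul_mem_halfspace.2 (disjoint_left.1 (disjoint_halfspace_neg u) hx)
  have heq := Set.eq_of_subset_of_ncard_le hsub
    (ncard_image_of_injective _ (mul_right_injective _)).ge hfin
  obtain ⟨x, hx, hx'⟩ := heq.symm.subset (t_zpow_mem_halfspace u)
  rw [mul_eq_left] at hx'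
  exact one_notMem_halfspace u (hx' ▸ hx)

theorem halfspace_eq_smul_compl (u : ℤˣ) :
    halfspace φ u = (t ^ (u : ℤ) : HNNExtension A F F' φ) • (halfspace φ (-u))ᶜ := by
  ext x
  rw [mem_smul_set_iff_inv_smul_mem, mem_compl_iff, ← t_zpow_mul_mem_halfspace, smul_eq_mul,
    mul_inv_cancel_left]

theorem isAlmostInvariant_halfspace [Finite F] [Finite F'] {S : Set A}
    (hS : Subgroup.closure S = ⊤) (u : ℤˣ) : IsAlmostInvariant (halfspace φ u) := by
  refine isAlmostInvariant_of_closure (closure_hnnGenSet (φ := φ) hS) fun s hs => ?_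
  have hfin : ((of : A →* HNNExtension A F F' φ) '' toSubgroup F F' (-u)).Finite := by
    refine Finite.image _ ?_
    rcases Int.units_eq_one_or u with rfl | rfl
    · exact toFinite (F' : Set A)
    · rw [neg_neg]; exact toFinite (F : Set A)
  refine (hfin.union (hfin.preimage (mul_left_injective s).injOn)).subset fun x hx => ?_
  have hcross := exists_of_of_crossing (isLetter_of_mem' (Or.inl hs)) x u
  by_cases h1 : x ∈ halfspace φ u
  · obtain ⟨b, hb, hb'⟩ := hcross.1 h1 fun h2 => hx ⟨fun _ => h2, fun _ => h1⟩
    exact Or.inr ⟨b, hb, hb'.symm⟩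
  · by_cases h2 : x * s ∈ halfspace φ u
    · obtain ⟨b, hb, hb'⟩ := hcross.2 h1 h2
      exact Or.inl ⟨b, hb, hb'.symm⟩
    · exact absurd ⟨fun h => absurd h h1, fun h => absurd h h2⟩ hx

variable (φ) in
/-- The translating element of a halfspace, where the whole group is the halfspace `none`. -/
def translator : Option ℤˣ → HNNExtension A F F' φ
  | none => 1
  | some u => t ^ (u : ℤ)

variable (φ) in
/-- The part of the group that is missing in a halfspace, before translating. -/
def missing : Option ℤˣ → Set (HNNExtension A F F' φ)
  | none => ∅
  | some u => halfspace φ (-u)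

theorem missing_eq_or_disjoint (τ : Option ℤˣ) (a : A) (v : ℤˣ) :
    (of a : HNNExtension A F F' φ) • halfspace φ v = missing φ τ ∨
      Disjoint (missing φ τ) ((of a : HNNExtension A F F' φ) • halfspace φ v) := by
  rcases τ with _ | u
  · exact Or.inr (empty_disjoint _)
  · have := smul_halfspace_eq_or_disjoint (φ := φ) a 1 v (-u)
    rw [map_one, one_smul] at this
    exact this.imp (fun h => h.1) fun h => h.symm

variable (φ) in
/-- The Bass–Serre decomposition of an HNN extension with finite associated subgroups. -/
def halfspaceSystem [Finite F] [Finite F'] :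
    HalfspaceSystem (HNNExtension A F F' φ) (Option ℤˣ) where
  H τ := translator φ τ • (missing φ τ)ᶜ
  P τ := translator φ τ • range of
  -- The inequality excludes the branch leading back to the parent. Elements `a` of one coset give
  -- the same branch; keeping them all makes every element of the piece a root, at the price of
  -- allowing equal children.
  Ch τ := {c | ∃ (a : A) (v : ℤˣ), of a • halfspace φ v ≠ missing φ τ ∧
    c = (translator φ τ * of a, some v)}
  root := none
  H_root := by simp [translator, missing]
  one_mem := mem_smul_set.2 ⟨1, ⟨1, map_one _⟩, by simp [translator]⟩
  piece_subset τ := by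
    refine smul_set_mono ?_
    rintro _ ⟨a, rfl⟩
    rcases τ with _ | u
    · exact notMem_empty _
    · exact of_notMem_halfspace a _
  child_subset := by
    rintro τ _ ⟨a, v, hav, rfl⟩
    rw [mul_smul]
    refine smul_set_mono ?_
    change of a • t ^ (v : ℤ) • (halfspace φ (-v))ᶜ ⊆ _
    rw [← halfspace_eq_smul_compl]
    exact subset_compl_iff_disjoint_left.2 ((missing_eq_or_disjoint τ a v).resolve_left hav)
  child_mem := by
    rintro τ _ ⟨a, v, hav, rfl⟩
    exact smul_mem_smul_set ⟨a, rfl⟩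
  exists_child := by
    rintro τ _ ⟨_, ⟨a, rfl⟩, rfl⟩
    rcases τ with _ | u
    · refine ⟨_, ⟨a, 1, fun h => ?_, rfl⟩, rfl⟩
      exact (infinite_halfspace 1).smul_set.nonempty.ne_empty h
    · refine ⟨_, ⟨a, u, fun h => ?_, rfl⟩, rfl⟩
      have h1 := h.subset (smul_mem_smul_set (t_zpow_mem_halfspace u))
      exact units_ne_neg u ((of_mul_mem_halfspace (t_zpow_mem_halfspace u)).1 h1).1.symm
  cover := by
    rintro τ _ ⟨x, hx, rfl⟩
    rcases of_or_mem_halfspace x with ⟨a, rfl⟩ | ⟨a, v, hav⟩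
    · exact Or.inl (smul_mem_smul_set ⟨a, rfl⟩)
    · refine Or.inr (mem_iUnion₂.2 ⟨(translator φ τ * of a, some v), ⟨a, v, fun h => ?_, rfl⟩, ?_⟩)
      · exact hx (h.subset (mem_smul_set_iff_inv_smul_mem.2 hav))
      · rw [mul_smul]
        refine smul_mem_smul_set ?_
        change x ∈ of a • t ^ (v : ℤ) • (halfspace φ (-v))ᶜ
        rw [← halfspace_eq_smul_compl]
        exact mem_smul_set_iff_inv_smul_mem.2 hav
  piece_disjoint := by
    rintro τ _ ⟨a, v, hav, rfl⟩
    rw [mul_smul, disjoint_smul_set]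
    change Disjoint _ (of a • t ^ (v : ℤ) • (halfspace φ (-v))ᶜ)
    rw [← halfspace_eq_smul_compl]
    refine disjoint_left.2 ?_
    rintro _ ⟨b, rfl⟩ h
    rw [mem_smul_set_iff_inv_smul_mem, ← map_inv, smul_eq_mul, ← map_mul] at h
    exact of_notMem_halfspace _ _ h
  child_disjoint := by
    rintro τ _ ⟨a, v, hav, rfl⟩ _ ⟨b, w, hbw, rfl⟩
    rw [mul_smul, mul_smul, disjoint_smul_set]
    change _ • of a • t ^ (v : ℤ) • (halfspace φ (-v))ᶜ =
      _ • of b • t ^ (w : ℤ) • (halfspace φ (-w))ᶜ ∨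
      Disjoint (of a • t ^ (v : ℤ) • (halfspace φ (-v))ᶜ) (of b • t ^ (w : ℤ) • (halfspace φ (-w))ᶜ)
    rw [← halfspace_eq_smul_compl, ← halfspace_eq_smul_compl]
    exact (smul_halfspace_eq_or_disjoint a b v w).imp (fun h => by rw [h.1]) id
  almostInvariant τ := by
    rcases τ with _ | u
    · refine isAlmostInvariant_of_closure Subgroup.closure_univ fun s _ => ?_
      simp [translator, missing]
    · change IsAlmostInvariant (t ^ (u : ℤ) • (halfspace φ (-u))ᶜ)
      rw [← halfspace_eq_smul_compl]
      exact isAlmostInvariant_halfspace Subgroup.closure_univ u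
  infinite τ := by
    rcases τ with _ | u
    · refine Infinite.mono ?_ (infinite_halfspace (φ := φ) 1)
      simp [translator, missing]
    · change (t ^ (u : ℤ) • (halfspace φ (-u))ᶜ).Infinite
      rw [← halfspace_eq_smul_compl]
      exact infinite_halfspace u

open Classical in
variable (φ) in
/-- The base element at which the branch containing an element of the HNN extension is attached, up
to the choice of a representative for each branch. -/
noncomputable def retraction (x : HNNExtension A F F' φ) : A :=
  if h : ∃ a, of a = x then h.choose
  else Classical.epsilon fun a : A => ∃ u : ℤˣ, (of a : HNNExtension A F F' φ) • halfspace φ u =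
    ⋃ (b : A) (v : ℤˣ) (_ : x ∈ (of b : HNNExtension A F F' φ) • halfspace φ v),
      (of b : HNNExtension A F F' φ) • halfspace φ v

theorem retraction_of (a : A) : retraction φ (of a) = a := by
  have h : ∃ b, (of b : HNNExtension A F F' φ) = of a := ⟨a, rfl⟩
  rw [retraction, dif_pos h]
  exact of_injective φ h.choose_spec

theorem notMem_range_of_of_mem {x : HNNExtension A F F' φ} {a : A} {u : ℤˣ}
    (hx : x ∈ (of a : HNNExtension A F F' φ) • halfspace φ u) : ¬ ∃ b, of b = x := by
  rintro ⟨b, rfl⟩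
  rw [mem_smul_set_iff_inv_smul_mem, ← map_inv, smul_eq_mul, ← map_mul] at hx
  exact of_notMem_halfspace _ _ hx

/-- The union in the definition collapses to the one branch containing `x`, so the chosen
representative depends on the branch only. -/
theorem retraction_eq {x : HNNExtension A F F' φ} {a : A} {u : ℤˣ}
    (hx : x ∈ (of a : HNNExtension A F F' φ) • halfspace φ u) :
    retraction φ x = Classical.epsilon fun b : A => ∃ v : ℤˣ,
      (of b : HNNExtension A F F' φ) • halfspace φ v =
        (of a : HNNExtension A F F' φ) • halfspace φ u := by
  rw [retraction, dif_neg (notMem_range_of_of_mem hx)]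
  congr! 5
  refine Subset.antisymm (iUnion₂_subset fun b v => iUnion_subset fun hb => ?_) ?_
  · rcases smul_halfspace_eq_or_disjoint (φ := φ) b a v u with h | h
    · exact h.1.subset
    · exact absurd hx (disjoint_left.1 h hb)
  · exact subset_iUnion₂_of_subset a u (subset_iUnion_of_subset hx subset_rfl)

theorem retraction_inv_mul_mem {x : HNNExtension A F F' φ} {a : A} {u : ℤˣ}
    (hx : x ∈ (of a : HNNExtension A F F' φ) • halfspace φ u) :
    (retraction φ x)⁻¹ * a ∈ toSubgroup F F' (-u) := by
  rw [retraction_eq hx]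
  obtain ⟨v, hv⟩ := Classical.epsilon_spec (p := fun b : A => ∃ v : ℤˣ,
    (of b : HNNExtension A F F' φ) • halfspace φ v =
      (of a : HNNExtension A F F' φ) • halfspace φ u) ⟨a, u, rfl⟩
  refine ((smul_halfspace_eq_or_disjoint (φ := φ) a _ u v).resolve_right fun h => ?_).2.2
  rw [hv, disjoint_self] at h
  exact h.subset hx

variable {S : Set A} {f : ℕ → ℝ}

/-- An edge from `a` to `a * t ^ u` goes to the pair formed by `a` and the representative of its
branch. These differ by an element of an associated subgroup, which is trivial or a generator. -/
theorem retraction_adj (hF : (F : Set A) \ {1} ⊆ S) (hF' : (F' : Set A) \ {1} ⊆ S)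
    {x y : HNNExtension A F F' φ} (h : (SimpleGraph.mulCayley (hnnGenSet φ S)).Adj x y)
    (hx : x ∈ range (of : A →* HNNExtension A F F' φ)) : retraction φ x = retraction φ y ∨
      (SimpleGraph.mulCayley S).Adj (retraction φ x) (retraction φ y) := by
  obtain ⟨a, rfl⟩ := hx
  obtain ⟨s, hs, rfl⟩ := exists_mul_of_mulCayley_adj h
  rw [or_iff_not_imp_left]
  intro hne
  rcases isLetter_of_mem hs with ⟨c, hc, rfl⟩ | ⟨u, rfl⟩
  · rw [← map_mul, retraction_of, retraction_of] at hne ⊢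
    exact mulCayley_adj_mul hc fun h => hne (by rw [h, mul_one])
  · have hmem : of a * t ^ (u : ℤ) ∈ (of a : HNNExtension A F F' φ) • halfspace φ u :=
      smul_mem_smul_set (t_zpow_mem_halfspace u)
    have hb := retraction_inv_mul_mem hmem
    set b := retraction φ (of a * t ^ (u : ℤ))
    rw [retraction_of] at hne ⊢
    have h1 : b⁻¹ * a ≠ 1 := fun h => hne (inv_mul_eq_one.1 h).symm
    have h2 : b⁻¹ * a ∈ S := by
      rcases Int.units_eq_one_or u with rfl | rfl
      · exact hF' ⟨hb, h1⟩
      · rw [neg_neg] at hb; exact hF ⟨hb, h1⟩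
    have h3 := mulCayley_adj_mul (x := b) (Or.inl h2) h1
    rw [mul_inv_cancel_left] at h3
    exact h3.symm

/-- An edge can leave a branch only through the base group, so an edge avoiding the base group stays
in one branch. -/
theorem retraction_eq_of_adj {x y : HNNExtension A F F' φ}
    (h : (SimpleGraph.mulCayley (hnnGenSet φ S)).Adj x y)
    (hx : x ∉ range (of : A →* HNNExtension A F F' φ))
    (hy : y ∉ range (of : A →* HNNExtension A F F' φ)) : retraction φ x = retraction φ y := by
  obtain ⟨s, hs, rfl⟩ := exists_mul_of_mulCayley_adj h
  obtain ⟨a, u, hau⟩ := (of_or_mem_halfspace x).resolve_left hx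
  have hxm : x ∈ (of a : HNNExtension A F F' φ) • halfspace φ u :=
    mem_smul_set_iff_inv_smul_mem.2 hau
  have hym : x * s ∈ (of a : HNNExtension A F F' φ) • halfspace φ u := by
    refine mem_smul_set_iff_inv_smul_mem.2 ?_
    by_contra hcon
    rw [smul_eq_mul, ← mul_assoc] at hcon
    obtain ⟨b, -, hb⟩ := (exists_of_of_crossing (isLetter_of_mem' hs) _ u).1 hau hcon
    refine hy ⟨a * b, ?_⟩
    rw [map_mul, ← hb]
    group
  rw [retraction_eq hxm, retraction_eq hym]

theorem isPieceTree_limitSets [Finite F] [Finite F'] [hS : Fact (IsFiniteGenSet S)]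
    [hS' : Fact (IsFiniteGenSet (hnnGenSet φ S))] [hf : Fact (IsFloydFunction f)]
    (hF : (F : Set A) \ {1} ⊆ S) (hF' : (F' : Set A) \ {1} ⊆ S) :
    IsPieceTree (completionRemainder (FloydSpace f S))
      ((halfspaceSystem φ).limitSets f (hnnGenSet φ S)) := by
  refine (halfspaceSystem φ).isPieceTree fun c => ?_
  refine exists_embedding_range_eq_floydLimitSet (isUniformInducing_mul_of_retraction
    hS'.out hf.out hS.out of (fun s hs => Or.inl ⟨s, hs, rfl⟩) (retraction φ)
    retraction_of (fun x y h hx => retraction_adj hF hF' h hx)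
    (fun x y h hx hy => retraction_eq_of_adj h hx hy) (c.1 * translator φ c.2)) (P := _) ?_ ?_
  · rintro _ ⟨_, ⟨_, ⟨a, rfl⟩, rfl⟩, rfl⟩
    exact ⟨a, mul_assoc _ _ _⟩
  · convert finite_empty
    rw [sdiff_eq_empty]
    rintro _ ⟨a, rfl⟩
    exact ⟨_, ⟨_, ⟨a, rfl⟩, rfl⟩, (mul_assoc _ _ _).symm⟩

theorem nonempty_homeomorph_floydBoundary_cantorSpace [Finite A] (hFF' : F ≠ ⊤ ∨ F' ≠ ⊤)
    {S : Set (HNNExtension A F F' φ)} (hS : IsFiniteGenSet S) (hf : IsFloydFunction f) :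
    Nonempty (floydBoundary f S ≃ₜ (ℕ → Bool)) := by
  have : Fact (IsFiniteGenSet S) := ⟨hS⟩
  have : Fact (IsFloydFunction f) := ⟨hf⟩
  -- In a finite group the isomorphic subgroups `F` and `F'` have equal order, so both are proper as
  -- soon as one is.
  have htop : F = ⊤ ↔ F' = ⊤ := by
    have hcard := Nat.card_congr φ.toEquiv
    constructor <;> rintro rfl
    · refine Subgroup.eq_top_of_card_eq _ ?_
      rw [← hcard, Subgroup.card_top]
    · refine Subgroup.eq_top_of_card_eq _ ?_
      rw [hcard, Subgroup.card_top]
  have hne : ∀ u : ℤˣ, ∃ a, a ∉ toSubgroup F F' u := by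
    intro u
    by_contra! hcon
    have hu : toSubgroup F F' u = ⊤ := (Subgroup.eq_top_iff' _).2 hcon
    rcases Int.units_eq_one_or u with rfl | rfl
    · exact hFF'.elim (· hu) (· (htop.1 hu))
    · exact hFF'.elim (· (htop.2 hu)) (· hu)
  refine (halfspaceSystem φ).nonempty_homeomorph_cantorSpace
    (fun τ => (finite_range (of : A →* HNNExtension A F F' φ)).smul_set) fun τ => ?_
  have hchild : ∀ (τ : Option ℤˣ) (a b : A) (v w : ℤˣ),
      (of a : HNNExtension A F F' φ) • halfspace φ v ≠ missing φ τ →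
      (of b : HNNExtension A F F' φ) • halfspace φ w ≠ missing φ τ →
      ¬ (v = w ∧ b⁻¹ * a ∈ toSubgroup F F' (-v)) →
      ∃ c ∈ (halfspaceSystem φ).Ch τ, ∃ c' ∈ (halfspaceSystem φ).Ch τ,
        Disjoint (c.1 • (halfspaceSystem φ).H c.2) (c'.1 • (halfspaceSystem φ).H c'.2) := by
    intro τ a b v w h1 h2 h3
    refine ⟨_, ⟨a, v, h1, rfl⟩, _, ⟨b, w, h2, rfl⟩, ?_⟩
    rw [mul_smul, mul_smul, disjoint_smul_set]
    change Disjoint (of a • t ^ (v : ℤ) • (halfspace φ (-v))ᶜ)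
      (of b • t ^ (w : ℤ) • (halfspace φ (-w))ᶜ)
    rw [← halfspace_eq_smul_compl, ← halfspace_eq_smul_compl]
    exact (smul_halfspace_eq_or_disjoint a b v w).resolve_left fun h => h3 h.2
  have hnonempty : ∀ (a : A) (v : ℤˣ), (of a : HNNExtension A F F' φ) • halfspace φ v ≠ ∅ :=
    fun a v => (infinite_halfspace v).smul_set.nonempty.ne_empty
  -- At the root the two signs give disjoint children. Below the root, two cosets of the proper
  -- subgroup give disjoint children of the same sign, and this sign differs from that of the branch
  -- to the parent.
  rcases τ with _ | u
  · exact hchild none 1 1 1 (-1) (hnonempty _ _) (hnonempty _ _) fun h => units_ne_neg 1 h.1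
  · obtain ⟨a, ha⟩ := hne (-u)
    have hneg : ∀ b : A, (of b : HNNExtension A F F' φ) • halfspace φ u ≠ halfspace φ (-u) := by
      intro b h
      have h1 := h.subset (smul_mem_smul_set (t_zpow_mem_halfspace u))
      exact units_ne_neg u ((of_mul_mem_halfspace (t_zpow_mem_halfspace u)).1 h1).1.symm
    refine hchild (some u) a 1 u u (hneg _) (hneg _) fun h => ha ?_
    simpa using h.2

end HNNExtension

/-! ### Halfspaces and retractions in the free product. -/

namespace Monoid.Coprod

open CoprodI.Word

variable {A : Type*} [Group A]

/-- The two embeddings of a group into its free product with itself. -/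
def factor (i : Bool) : A →* Coprod A A :=
  bif i then inr else inl

/-- The free product of two copies of a group as a free product indexed by the booleans. -/
def toCoprodI : Coprod A A →* CoprodI fun _ : Bool => A :=
  lift (CoprodI.of (M := fun _ : Bool => A) (i := false)) (CoprodI.of (M := fun _ : Bool => A) (i := true))

theorem toCoprodI_factor (i : Bool) (a : A) :
    toCoprodI (factor i a) = CoprodI.of (M := fun _ : Bool => A) (i := i) a := by
  cases i
  · exact lift_apply_inl _ _ a
  · exact lift_apply_inr _ _ a

theorem lift_factor_toCoprodI (x : Coprod A A) : CoprodI.lift factor (toCoprodI x) = x := by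
  have h : (CoprodI.lift (factor (A := A))).comp toCoprodI = MonoidHom.id (Coprod A A) := by
    refine hom_ext (MonoidHom.ext fun a => ?_) (MonoidHom.ext fun a => ?_)
    · exact CoprodI.lift_of (M := fun _ : Bool => A) (i := false) factor a
    · exact CoprodI.lift_of (M := fun _ : Bool => A) (i := true) factor a
  exact DFunLike.congr_fun h x

open Classical in
/-- The elements of the free product whose reduced word begins in the factor `i`. -/
def halfspace (A : Type*) [Group A] (i : Bool) : Set (Coprod A A) :=
  {x | (equiv (toCoprodI x)).fstIdx = some i}

theorem one_notMem_halfspace (i : Bool) : 1 ∉ halfspace A i := by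
  classical
  have h : equiv (1 : CoprodI fun _ : Bool => A) = empty := by
    rw [← Equiv.eq_symm_apply]
    exact prod_empty.symm
  simp [halfspace, h, fstIdx, CoprodI.Word.empty]

theorem disjoint_halfspace {i j : Bool} (hij : i ≠ j) :
    Disjoint (halfspace A i) (halfspace A j) := by
  refine disjoint_left.2 fun x hx hx' => hij ?_
  exact Option.some.inj (hx.symm.trans hx')

theorem factor_mul_mem_halfspace {i : Bool} {a : A} (ha : a ≠ 1) {x : Coprod A A}
    (hx : x ∉ halfspace A i) : factor i a * x ∈ halfspace A i := by
  classical
  have h : equiv (toCoprodI (factor i a * x)) =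
      cons (M := fun _ : Bool => A) a (equiv (toCoprodI x)) hx ha := by
    rw [← Equiv.eq_symm_apply]
    refine Eq.trans ?_ (prod_cons i a _ ha hx).symm
    rw [map_mul, toCoprodI_factor]
    exact congrArg _ (equiv.symm_apply_apply _).symm
  exact (congrArg fstIdx h).trans (fstIdx_cons _ _ _ _)

theorem word_induction {p : Coprod A A → Prop} (one : p 1)
    (cons : ∀ (i : Bool) (a : A) (x), a ≠ 1 → x ∉ halfspace A i → p x → p (factor i a * x))
    (x : Coprod A A) : p x := by
  classical
  -- The round trip through `toCoprodI` is carried along in the induction, to transfer the condition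
  -- on the first letter.
  have key : ∀ w : CoprodI.Word fun _ : Bool => A,
      p (CoprodI.lift factor w.prod) ∧ toCoprodI (CoprodI.lift factor w.prod) = w.prod := by
    intro w
    induction w using consRecOn with
    | empty => simpa using one
    | cons i a w h1 h2 ih =>
      rw [prod_cons, map_mul, map_mul, CoprodI.lift_of, toCoprodI_factor, ih.2]
      refine ⟨cons i a _ h2 (fun h => h1 ?_) ih.1, rfl⟩
      have h' : (equiv (toCoprodI (CoprodI.lift factor w.prod))).fstIdx = some i := h
      rw [ih.2] at h'
      exact (congrArg fstIdx (equiv.apply_symm_apply w)).symm.trans h'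
  have h := (key (equiv (toCoprodI x))).1
  have h2 : (equiv (toCoprodI x)).prod = toCoprodI x := equiv.symm_apply_apply _
  rwa [h2, lift_factor_toCoprodI] at h

theorem factor_mem_halfspace {i : Bool} {a : A} (ha : a ≠ 1) : factor i a ∈ halfspace A i := by
  simpa using factor_mul_mem_halfspace ha (one_notMem_halfspace i)

theorem factor_notMem_halfspace {i j : Bool} (hij : i ≠ j) (a : A) : factor i a ∉ halfspace A j := by
  rcases eq_or_ne a 1 with rfl | ha
  · rw [map_one]; exact one_notMem_halfspace j
  · exact disjoint_left.1 (disjoint_halfspace hij) (factor_mem_halfspace ha)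

theorem mem_halfspace_not {i : Bool} {x : Coprod A A} (hx : x ∉ halfspace A i) :
    x = 1 ∨ x ∈ halfspace A !i := by
  induction x using word_induction with
  | one => exact Or.inl rfl
  | cons j a x ha hxj _ =>
    have h := factor_mul_mem_halfspace ha hxj
    rcases eq_or_ne j i with rfl | hji
    · exact absurd h hx
    · rw [Bool.eq_not.2 hji] at h ⊢
      exact Or.inr h

theorem exists_factor_inv_mul_notMem (i : Bool) (x : Coprod A A) :
    ∃ a, factor i a⁻¹ * x ∉ halfspace A i := by
  induction x using word_induction with
  | one => exact ⟨1, by simpa using one_notMem_halfspace i⟩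
  | cons j a x ha hxj _ =>
    rcases eq_or_ne j i with rfl | hji
    · exact ⟨a, by simpa using hxj⟩
    · refine ⟨1, ?_⟩
      simpa using disjoint_left.1 (disjoint_halfspace hji) (factor_mul_mem_halfspace ha hxj)

/-- The first letter of a reduced word, if it lies in the factor `i`. -/
noncomputable def retraction (i : Bool) (x : Coprod A A) : A :=
  (exists_factor_inv_mul_notMem i x).choose

/-- Two different candidates would differ by a nontrivial element of the factor, and prepending that
element creates a word beginning in the factor. -/
theorem retraction_eq_iff {i : Bool} {x : Coprod A A} {a : A} :
    retraction i x = a ↔ factor i a⁻¹ * x ∉ halfspace A i := by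
  have h : factor i (retraction i x)⁻¹ * x ∉ halfspace A i :=
    (exists_factor_inv_mul_notMem i x).choose_spec
  refine ⟨fun hx => hx ▸ h, fun ha => ?_⟩
  by_contra hne
  refine ha ?_
  have := factor_mul_mem_halfspace (a := a⁻¹ * retraction i x)
    (fun h => hne (inv_mul_eq_one.1 h).symm) h
  rwa [← mul_assoc, ← map_mul, mul_inv_cancel_right] at this

theorem retraction_factor_mul {i : Bool} (a : A) {x : Coprod A A} (hx : x ∉ halfspace A i) :
    retraction i (factor i a * x) = a :=
  retraction_eq_iff.2 (by simpa using hx)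

theorem retraction_factor (i : Bool) (a : A) : retraction i (factor i a) = a := by
  simpa using retraction_factor_mul a (one_notMem_halfspace i)

theorem mem_halfspace_iff {i : Bool} {x : Coprod A A} : x ∈ halfspace A i ↔ retraction i x ≠ 1 := by
  rw [Ne, retraction_eq_iff]
  simp

theorem factor_injective (i : Bool) : Function.Injective (factor i : A →* Coprod A A) :=
  Function.LeftInverse.injective (retraction_factor i)

/-- The edge groups are trivial here: the outer endpoint of an edge crossing the boundary of a
halfspace is the identity. -/
theorem eq_one_of_crossing {j : Bool} (c : A) (x : Coprod A A) : ∀ i : Bool,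
    (x ∈ halfspace A i → x * factor j c ∉ halfspace A i → x * factor j c = 1) ∧
    (x ∉ halfspace A i → x * factor j c ∈ halfspace A i → x = 1) := by
  induction x using word_induction with
  | one => exact fun i => ⟨fun h => absurd h (one_notMem_halfspace i), fun _ _ => rfl⟩
  | cons k a x ha hx ih =>
    intro i
    have hk := factor_mul_mem_halfspace ha hx
    have hback : x * factor j c ∈ halfspace A k → ∃ b, factor k a * x * factor j c = factor k b := by
      intro h
      obtain rfl := (ih k).2 hx h
      rw [one_mul] at h
      obtain rfl : j = k := by
        by_contra hjk
        exact factor_notMem_halfspace hjk c h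
      exact ⟨a * c, by rw [mul_one, map_mul]⟩
    constructor
    · intro h1 h2
      obtain rfl : k = i := by
        by_contra hki
        exact disjoint_left.1 (disjoint_halfspace hki) hk h1
      by_cases h : x * factor j c ∈ halfspace A k
      · obtain ⟨b, hb⟩ := hback h
        rw [hb] at h2 ⊢
        by_contra hcon
        exact h2 (factor_mem_halfspace fun hb => hcon (by rw [hb, map_one]))
      · rw [mul_assoc] at h2
        exact absurd (factor_mul_mem_halfspace ha h) h2
    · intro h1 h2
      have hki : k ≠ i := fun h => h1 (h ▸ hk)
      by_cases h : x * factor j c ∈ halfspace A k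
      · obtain ⟨b, hb⟩ := hback h
        rw [hb] at h2
        exact absurd h2 (factor_notMem_halfspace hki b)
      · have h3 := factor_mul_mem_halfspace ha h
        rw [← mul_assoc] at h3
        exact absurd h2 (disjoint_left.1 (disjoint_halfspace hki) h3)

theorem exists_factor_of_mem {S : Set A} {s : Coprod A A}
    (hs : s ∈ doubleGenSet S ∨ s⁻¹ ∈ doubleGenSet S) :
    ∃ (i : Bool) (a : A), (a ∈ S ∨ a⁻¹ ∈ S) ∧ s = factor i a := by
  rcases hs with (⟨a, ha, rfl⟩ | ⟨a, ha, rfl⟩) | (⟨a, ha, h⟩ | ⟨a, ha, h⟩)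
  · exact ⟨false, a, Or.inl ha, rfl⟩
  · exact ⟨true, a, Or.inl ha, rfl⟩
  · exact ⟨false, a⁻¹, Or.inr (by simpa using ha), by
      rw [map_inv]; exact (inv_eq_iff_eq_inv.2 h).symm⟩
  · exact ⟨true, a⁻¹, Or.inr (by simpa using ha), by
      rw [map_inv]; exact (inv_eq_iff_eq_inv.2 h).symm⟩

theorem closure_doubleGenSet {S : Set A} (hS : Subgroup.closure S = ⊤) :
    Subgroup.closure (doubleGenSet S) = ⊤ := by
  rw [doubleGenSet, Subgroup.closure_union, ← MonoidHom.map_closure, ← MonoidHom.map_closure, hS,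
    ← MonoidHom.range_eq_map, ← MonoidHom.range_eq_map, range_inl_sup_range_inr]

theorem isFiniteGenSet_doubleGenSet {S : Set A} (hS : IsFiniteGenSet S) :
    IsFiniteGenSet (doubleGenSet S) :=
  ⟨(hS.1.image _).union (hS.1.image _), closure_doubleGenSet hS.2⟩

theorem isAlmostInvariant_halfspace (i : Bool) : IsAlmostInvariant (halfspace A i) := by
  refine isAlmostInvariant_of_closure (closure_doubleGenSet (S := (univ : Set A))
    Subgroup.closure_univ) fun s hs => ?_
  obtain ⟨j, c, -, rfl⟩ := exists_factor_of_mem (Or.inl hs)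
  refine ((finite_singleton 1).insert (factor j c)⁻¹).subset fun x hx => ?_
  have hcross := eq_one_of_crossing (j := j) c x i
  by_cases h1 : x ∈ halfspace A i
  · exact Or.inl (eq_inv_of_mul_eq_one_left (hcross.1 h1 fun h2 => hx ⟨fun _ => h2, fun _ => h1⟩))
  · by_cases h2 : x * factor j c ∈ halfspace A i
    · exact Or.inr (hcross.2 h1 h2)
    · exact absurd ⟨fun h => absurd h h1, fun h => absurd h h2⟩ hx

/-- The factor in which the elements of a halfspace are rooted. -/
def rootFactor (τ : Option Bool) : Bool :=
  τ.getD false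

/-- The elements of the root factor that lie in a halfspace, the whole group being the halfspace
`none`. -/
def rootSet (A : Type*) [Group A] : Option Bool → Set A
  | none => univ
  | some _ => {1}ᶜ

theorem infinite_rootSet [Infinite A] (τ : Option Bool) : (rootSet A τ).Infinite := by
  rcases τ with _ | i
  · exact infinite_univ
  · exact (finite_singleton 1).infinite_compl

theorem ofPred_retraction_mem_rootSet (i : Bool) :
    {x : Coprod A A | retraction (rootFactor (some i)) x ∈ rootSet A (some i)} = halfspace A i :=
  Set.ext fun _ => mem_halfspace_iff.symm

theorem mem_smul_halfspace_not {i : Bool} {a : A} {x : Coprod A A} :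
    x ∈ (factor i a : Coprod A A) • halfspace A (!i) ↔ retraction i x = a ∧ x ≠ factor i a := by
  rw [mem_smul_set_iff_inv_smul_mem, smul_eq_mul, retraction_eq_iff, ← map_inv]
  constructor
  · intro h
    refine ⟨disjoint_right.1 (disjoint_halfspace (Bool.self_ne_not i)) h, ?_⟩
    rintro rfl
    rw [← map_mul, inv_mul_cancel, map_one] at h
    exact one_notMem_halfspace _ h
  · rintro ⟨h1, h2⟩
    refine (mem_halfspace_not h1).resolve_left fun h => h2 ?_
    rwa [map_inv, inv_mul_eq_one, eq_comm] at h

/-- The Bass–Serre decomposition of the free product of two copies of an infinite group. -/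
noncomputable def halfspaceSystem (A : Type*) [Group A] [Infinite A] :
    HalfspaceSystem (Coprod A A) (Option Bool) where
  H τ := {x | retraction (rootFactor τ) x ∈ rootSet A τ}
  P τ := factor (rootFactor τ) '' rootSet A τ
  -- Each element of the piece carries exactly one branch, that of the words continuing in the other
  -- factor.
  Ch τ := (fun a => (factor (rootFactor τ) a, some !rootFactor τ)) '' rootSet A τ
  root := none
  H_root := eq_univ_of_forall fun _ => mem_univ _
  one_mem := ⟨1, mem_univ _, map_one _⟩
  piece_subset τ := by
    rintro _ ⟨a, ha, rfl⟩
    rwa [mem_ofPred_eq, retraction_factor]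
  child_subset := by
    rintro τ _ ⟨a, ha, rfl⟩ x hx
    rw [ofPred_retraction_mem_rootSet, mem_smul_halfspace_not] at hx
    rwa [mem_ofPred_eq, hx.1]
  child_mem := by
    rintro τ _ ⟨a, ha, rfl⟩
    exact ⟨a, ha, rfl⟩
  exists_child := by
    rintro τ _ ⟨a, ha, rfl⟩
    exact ⟨_, ⟨a, ha, rfl⟩, rfl⟩
  cover := by
    intro τ x hx
    rw [mem_union, or_iff_not_imp_left]
    intro hxP
    refine mem_iUnion₂.2 ⟨_, ⟨_, hx, rfl⟩, ?_⟩
    rw [ofPred_retraction_mem_rootSet, mem_smul_halfspace_not]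
    exact ⟨rfl, fun h => hxP ⟨_, hx, h.symm⟩⟩
  piece_disjoint := by
    rintro τ _ ⟨a, ha, rfl⟩
    rw [ofPred_retraction_mem_rootSet]
    refine disjoint_left.2 ?_
    rintro _ ⟨b, hb, rfl⟩ h
    obtain ⟨h1, h2⟩ := mem_smul_halfspace_not.1 h
    rw [retraction_factor] at h1
    exact h2 (by rw [h1])
  child_disjoint := by
    rintro τ _ ⟨a, ha, rfl⟩ _ ⟨b, hb, rfl⟩
    rw [ofPred_retraction_mem_rootSet, or_iff_not_imp_right, not_disjoint_iff]
    rintro ⟨x, hx, hx'⟩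
    rw [← (mem_smul_halfspace_not.1 hx).1, ← (mem_smul_halfspace_not.1 hx').1]
  almostInvariant τ := by
    rcases τ with _ | i
    · refine isAlmostInvariant_of_closure Subgroup.closure_univ fun s _ => ?_
      simp [rootSet]
    · rw [ofPred_retraction_mem_rootSet]
      exact isAlmostInvariant_halfspace i
  infinite τ := by
    refine ((infinite_rootSet τ).image (factor_injective (rootFactor τ)).injOn).mono ?_
    rintro _ ⟨a, ha, rfl⟩
    rwa [mem_ofPred_eq, retraction_factor]

variable {S : Set A} {f : ℕ → ℝ}

theorem retraction_adj {i : Bool} {x y : Coprod A A}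
    (h : (SimpleGraph.mulCayley (doubleGenSet S)).Adj x y)
    (hx : x ∈ range (factor i : A →* Coprod A A)) : retraction i x = retraction i y ∨
      (SimpleGraph.mulCayley S).Adj (retraction i x) (retraction i y) := by
  obtain ⟨a, rfl⟩ := hx
  obtain ⟨s, hs, rfl⟩ := exists_mul_of_mulCayley_adj h
  obtain ⟨j, c, hc, rfl⟩ := exists_factor_of_mem hs
  rcases eq_or_ne j i with rfl | hji
  · rw [or_iff_not_imp_left, ← map_mul, retraction_factor, retraction_factor]
    exact fun hne => mulCayley_adj_mul hc fun h => hne (by rw [h, mul_one])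
  · left
    rw [retraction_factor_mul a (factor_notMem_halfspace hji c), retraction_factor]

/-- After removing the first letter from the factor `i`, the word could change side only at the
identity, that is, only if `x` were in the factor. -/
theorem retraction_eq_of_adj {i : Bool} {x y : Coprod A A}
    (h : (SimpleGraph.mulCayley (doubleGenSet S)).Adj x y)
    (hx : x ∉ range (factor i : A →* Coprod A A)) : retraction i x = retraction i y := by
  obtain ⟨s, hs, rfl⟩ := exists_mul_of_mulCayley_adj h
  obtain ⟨j, c, hc, rfl⟩ := exists_factor_of_mem hs
  have h1 := retraction_eq_iff.1 (rfl : retraction i x = _)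
  refine (retraction_eq_iff.2 fun h2 => hx ?_).symm
  rw [← mul_assoc] at h2
  have h3 := (eq_one_of_crossing c _ i).2 h1 h2
  rw [map_inv, inv_mul_eq_one] at h3
  exact ⟨_, h3⟩

theorem isPieceTree_limitSets [Infinite A] [hS : Fact (IsFiniteGenSet S)]
    [hS' : Fact (IsFiniteGenSet (doubleGenSet S))] [hf : Fact (IsFloydFunction f)] :
    IsPieceTree (completionRemainder (FloydSpace f S))
      ((halfspaceSystem A).limitSets f (doubleGenSet S)) := by
  refine (halfspaceSystem A).isPieceTree fun c => ?_
  refine exists_embedding_range_eq_floydLimitSet (isUniformInducing_mul_of_retraction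
    hS'.out hf.out hS.out (factor (rootFactor c.2)) (fun s hs => ?_)
    (retraction (rootFactor c.2)) (retraction_factor _)
    (fun x y h hx => retraction_adj h hx)
    (fun x y h hx _ => retraction_eq_of_adj h hx) c.1) (P := _) ?_ ?_
  · cases rootFactor c.2
    · exact Or.inl ⟨s, hs, rfl⟩
    · exact Or.inr ⟨s, hs, rfl⟩
  · rintro _ ⟨_, ⟨a, -, rfl⟩, rfl⟩
    exact ⟨a, rfl⟩
  -- Below the root, the piece is the coset without its base point `c.1`.
  · refine (finite_singleton c.1).subset ?_
    rintro _ ⟨⟨a, rfl⟩, ha⟩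
    by_contra hne
    refine ha ⟨_, ⟨a, ?_, rfl⟩, rfl⟩
    rcases c with ⟨k, _ | i⟩
    · exact mem_univ _
    · rintro rfl
      exact hne (by simp)

end Monoid.Coprod

/-! ### Comparison of the two boundaries. -/

theorem nonempty_floydBoundary_homeomorph {A : Type*} [Group A] [Infinite A] {F F' : Subgroup A}
    [Finite F] [Finite F'] (φ : F ≃* F') {f : ℕ → ℝ} (hf : IsFloydFunction f) {S : Set A}
    (hS : IsFiniteGenSet S) (hF : (F : Set A) \ {1} ⊆ S) (hF' : (F' : Set A) \ {1} ⊆ S) :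
    Nonempty (floydBoundary f (hnnGenSet φ S) ≃ₜ floydBoundary f (doubleGenSet S)) := by
  have : Fact (IsFiniteGenSet S) := ⟨hS⟩
  have : Fact (IsFiniteGenSet (hnnGenSet φ S)) := ⟨HNNExtension.isFiniteGenSet_hnnGenSet hS⟩
  have : Fact (IsFiniteGenSet (doubleGenSet S)) := ⟨Monoid.Coprod.isFiniteGenSet_doubleGenSet hS⟩
  have : Fact (IsFloydFunction f) := ⟨hf⟩
  obtain ⟨ξ, -⟩ := limitSet_nonempty (X := FloydSpace f S) (infinite_univ (α := A))
  have : Nonempty (completionRemainder (FloydSpace f S)) := ⟨ξ⟩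
  have e : Nonempty (completionRemainder (FloydSpace f (hnnGenSet φ S)) ≃ₜ
      completionRemainder (FloydSpace f (doubleGenSet S))) :=
    (HNNExtension.isPieceTree_limitSets hF hF').nonempty_homeomorph
      Monoid.Coprod.isPieceTree_limitSets
  exact e

theorem theorem5p5 {A : Type*} [Group A] [Group.FG A] (F F' : Subgroup A) [Finite F] [Finite F']
    (φ : F ≃* F') (f : ℕ → ℝ) (hf : IsFloydFunction f) :
    (Infinite A →
      (∀ S : Set A, IsFiniteGenSet S → (F : Set A) \ {1} ⊆ S → (F' : Set A) \ {1} ⊆ S →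
        Nonempty (floydBoundary f (hnnGenSet φ S) ≃ₜ floydBoundary f (doubleGenSet S))) ∧
      ((∃ D : ℝ, ∀ n : ℕ, f n ≤ D * f (2 * n)) →
        ∀ (S : Set (HNNExtension A F F' φ)) (S' : Set (Monoid.Coprod A A)),
          IsFiniteGenSet S → IsFiniteGenSet S' →
            Nonempty (floydBoundary f S ≃ₜ floydBoundary f S'))) ∧
    (Finite A → (F ≠ ⊤ ∨ F' ≠ ⊤) →
      ∀ S : Set (HNNExtension A F F' φ), IsFiniteGenSet S →
        Nonempty (floydBoundary f S ≃ₜ (ℕ → Bool))) := by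
  refine ⟨fun _ => ⟨fun S hS hF hF' => nonempty_floydBoundary_homeomorph φ hf hS hF hF',
    fun hD S S' hS hS' => ?_⟩, fun _ hFF' S hS =>
      HNNExtension.nonempty_homeomorph_floydBoundary_cantorSpace hFF' hS hf⟩
  obtain ⟨S₀, hS₀, hfin⟩ := (Group.fg_iff (G := A)).1 inferInstance
  -- Adding the finite subgroups to the generators makes part (a) applicable; doubling then connects
  -- both ends to arbitrary generating sets.
  have hgen : IsFiniteGenSet (S₀ ∪ (F ∪ F')) := by
    refine ⟨hfin.union ((toFinite (F : Set A)).union (toFinite (F' : Set A))), ?_⟩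
    exact top_unique (hS₀.ge.trans (Subgroup.closure_mono subset_union_left))
  obtain ⟨e₁⟩ := nonempty_homeomorph_floydBoundary_change hS
    (HNNExtension.isFiniteGenSet_hnnGenSet (φ := φ) hgen) hf hD
  obtain ⟨e₂⟩ := nonempty_floydBoundary_homeomorph φ hf hgen
    (sdiff_subset.trans (subset_union_left.trans subset_union_right))
    (sdiff_subset.trans (subset_union_right.trans subset_union_right))
  obtain ⟨e₃⟩ := nonempty_homeomorph_floydBoundary_change
    (Monoid.Coprod.isFiniteGenSet_doubleGenSet hgen) hS' hf hD
  exact ⟨e₁.trans (e₂.trans e₃)⟩
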